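/- Let $\omega=e^1\wedge e^2+e^3\wedge e^4$ on $\mathbb R^4=\mathrm{span}\{e_1,\dots,e_4\}$, let $a,b,c\in\mathbb R$, and let $\nabla,\nabla'=\nabla'_{a,b,c}:\mathbb R^4\times\mathbb R^4\to\mathbb R^4$ be the bilinear maps $(x,y)\mapsto\nabla_xy,\ \nabla'_xy$ given by $$\nabla_{e_1}=\nabla_{e_3}=\begin{pmatrix}1&0&1&0\\0&-1&0&1\\-1&0&-1&0\\0&-1&0&1\end{pmatrix},\qquad \nabla_{e_4}=-\nabla_{e_2}=\begin{pmatrix}0&0&0&0\\1&0&1&0\\0&0&0&0\\1&0&1&0\end{pmatrix},\qquad \nabla'_{e_2}=a\nabla_{e_2},\quad \nabla'_{e_4}=a\nabla_{e_4},$$ $$\nabla'_{e_1}=\begin{pmatrix}a&0&a&0\\b&-a&c&a\\-a&0&-a&0\\c&-a&-b+2c&a\end{pmatrix},\qquad \nabla'_{e_3}=\begin{pmatrix}a&0&a&0\\c&-a&-b+2c&a\\-a&0&-a&0\\-b+2c&-a&-2b+3c&a\end{pmatrix}.$$ (1) $\nabla$ and $\nabla'$ are affine structures ($\nabla_xy=\nabla_yx$,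 $\nabla_x\nabla_y=\nabla_y\nabla_x$, and likewise for $\nabla'$), both are compatible with the symplectic form $\omega$ (that is, $\omega(\nabla_xy,z)=\omega(\nabla_xz,y)$, and likewise for $\nabla'$), and $\nabla_x\nabla'_y=\nabla_y\nabla'_x$ for all $x,y$. Hence $\mathbb R^4\times\mathbb R^4$ is a Lie group $N=N_{\nabla,\nabla'}$ for the product $(x,x')\cdot(y,y')=(x+\alpha(x',y),\beta(x',y)+y')$ with $$\alpha(x',y)=y+\nabla'_yx'-\tfrac12\nabla'_y\nabla_yx',\qquad \beta(x',y)=x'-\nabla_{x'}y-\tfrac12\nabla_{x'}\nabla'_{x'}y.$$ With $s=x_1'+x_3'$ and $t=y_1+y_3$, the components are $$\begin{aligned}\alpha_1&=y_1+ats,\qquad \alpha_3=y_3-ats,\\ \alpha_2&=y_2+(by_1-ay_2+cy_3+ay_4)x_1'-atx_2'+(cy_1-ay_2+(-b+2c)y_3+ay_4)x_3'+atx_4'+\tfrac12(c-b)t^2s,\\ \alpha_4&=y_4+(cy_1-ay_2+(-b+2c)y_3+ay_4)x_1'-atx_2'+((-b+2c)y_1-ay_2+(-2b+3c)y_3+ay_4)x_3'+atx_4'+\tfrac12(c-b)t^2s,\\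 \beta_1&=x_1'-st,\qquad \beta_3=x_3'+st,\\ \beta_j&=x_j'+(x_2'-x_4')t+s(y_2-y_4)-\tfrac12(c-b)s^2t\qquad (j=2,4).\end{aligned}$$ The Lie bracket of its Lie algebra is $[(x,x'),(y,y')]=(\nabla'_yx'-\nabla'_xy',\ \nabla_xy'-\nabla_yx')$. In the global coordinates $x_1,\dots,x_4,x_1',\dots,x_4'$, the left-invariant 1-forms dual to the basis $e_i=(e_i,0)$, $f_i=(0,e_i)$ are $$\begin{aligned}e^1&=(1-as)\,dx_1-as\,dx_3,\qquad e^3=as\,dx_1+(1+as)\,dx_3,\\ e^2&=(-bx_1'+ax_2'-cx_3'-ax_4')dx_1+(1+as)dx_2+(-cx_1'+ax_2'-(-b+2c)x_3'-ax_4')dx_3-as\,dx_4,\\ e^4&=(-cx_1'+ax_2'-(-b+2c)x_3'-ax_4')dx_1+as\,dx_2+(-(-b+2c)x_1'+ax_2'-(-2b+3c)x_3'-ax_4')dx_3+(1-as)dx_4,\\ f^1&=s(dx_1+dx_3)+dx_1',\qquad f^3=-s(dx_1+dx_3)+dx_3',\\ f^j&=\left(-\tfrac12(c-b)s^2-x_2'+x_4'\right)(dx_1+dx_3)-s(dx_2-dx_4)+dx_j'\qquad(j=2,4).\end{aligned}$$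 (2) If $b\ne c$, then $N$ and its Lie algebra are nilpotent of step exactly $3$; if $b=c$, they are nilpotent of step exactly $2$. (3) Let $g$, $J$, $E$ be the left-invariant tensor fields on $N$ whose values at the identity are $g((x,x'),(y,y'))=-\omega(x,y')+\omega(x',y)$, $J(x,y)=(-y,x)$, $E(x,y)=(x,-y)$. Then $(J,E,g)$ is a hypersymplectic structure: $g$ is a pseudo-Riemannian metric of signature $(4,4)$, $J^2=-1$, $E^2=1$, $JE=-EJ$, $g(J\cdot,J\cdot)=g=-g(E\cdot,E\cdot)$, and the 2-forms $g(J\cdot,\cdot)$, $g(E\cdot,\cdot)$, $g(JE\cdot,\cdot)$ are closed. It is invariant under all left translations. Moreover $J$ is integrable, so that $(J,g)$ is neutral Kähler, $g$ is Ricci-flat and geodesically complete, and $g$ is flat if and only if $b=c$. (4) If $a,b,c\in\mathbb Q$, then $N$ has a discrete subgroup $\Gamma$ with $N/\Gamma$ compact. For arbitrary real $a,b,c$ and every discrete co-compact subgroup $\Gamma$ of $N$, the quotient $\Gamma\backslash N$ of $N$ by the left translations by elements of $\Gamma$ is a compact Hausdorff smooth manifold, the projection $N\to\Gamma\backslash N$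 is a local diffeomorphism, and $(J,E,g)$ induces on $\Gamma\backslash N$ a hypersymplectic structure with neutral Kähler, Ricci-flat, geodesically complete metric, which is flat if and only if $b=c$. (5) For $a=0$, $b=1$, $c=0$ the metric $g$ is, in the coordinates $x_1,\dots,x_4,x_1',\dots,x_4'$ of $\mathbb R^8$, $$\begin{aligned}g={}&\left(-\tfrac32(x_1'+x_3')^2+x_2'-x_4'\right)(dx_1+dx_3)^2+2(x_1'+x_3')(dx_1+dx_3)(dx_2-dx_4)-x_1'\,dx_1dx_1'\\&-dx_1dx_2'+dx_2dx_1'+x_3'(dx_1dx_3'+dx_3dx_1')+(x_1'+2x_3')\,dx_3dx_3'-dx_3dx_4'+dx_4dx_3',\end{aligned}$$ where $\varphi\psi=\varphi\otimes\psi+\psi\otimes\varphi$ denotes the symmetric product of 1-forms (in particular $\varphi^2=2\,\varphi\otimes\varphi$). This is a complete, non-flat, Ricci-flat, neutral Kähler metric on $\mathbb R^8$ (Kähler with respect to some complex structure $J$). -/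

import Mathlib

open scoped Manifold ContDiff Matrix

noncomputable section

/-! ### Affine structures compatible with a symplectic form -/

section AffineSymplectic

variable {V : Type*} [AddCommGroup V] [Module ℝ V]

/-- An affine structure on `V`: a bilinear map `(x, y) ↦ ∇_x y`, written `nabla x y`, with
`∇_x y = ∇_y x` and `∇_x ∇_y = ∇_y ∇_x`. -/
structure IsAffineStructure (nabla : V →ₗ[ℝ] V →ₗ[ℝ] V) : Prop where
  torsion_free : ∀ x y, nabla x y = nabla y x
  comm : ∀ x y, nabla x ∘ₗ nabla y = nabla y ∘ₗ nabla x

/-- A symplectic form on the vector space `V`: skew-symmetric and non-degenerate. -/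
structure IsSymplecticForm (omega : LinearMap.BilinForm ℝ V) : Prop where
  skew : ∀ x y, omega x y = -omega y x
  nondegenerate : omega.Nondegenerate

/-- Compatibility of an affine structure with `ω`: `ω (∇_x y, z) = ω (∇_x z, y)`. -/
def IsCompatibleWith (nabla : V →ₗ[ℝ] V →ₗ[ℝ] V) (omega : LinearMap.BilinForm ℝ V) : Prop :=
  ∀ x y z, omega (nabla x y) z = omega (nabla x z) y

/-- Compatibility of two affine structures: `∇_x ∇'_y = ∇_y ∇'_x`. -/
def AreCompatible (nabla nabla' : V →ₗ[ℝ] V →ₗ[ℝ] V) : Prop :=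
  ∀ x y, nabla x ∘ₗ nabla' y = nabla y ∘ₗ nabla' x

variable (V) in
/-- The data `(∇, ∇', ω)`: two affine structures on `V`, compatible with the symplectic form `ω`
and with each other. -/
structure AffineSymplecticPair where
  omega : LinearMap.BilinForm ℝ V
  nabla : V →ₗ[ℝ] V →ₗ[ℝ] V
  nabla' : V →ₗ[ℝ] V →ₗ[ℝ] V
  symplectic : IsSymplecticForm omega
  affine : IsAffineStructure nabla
  affine' : IsAffineStructure nabla'
  compat : IsCompatibleWith nabla omega
  compat' : IsCompatibleWith nabla' omega
  compatible : AreCompatible nabla nabla'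

namespace AffineSymplecticPair

variable (D : AffineSymplecticPair V)

theorem eq_zero_of_omega {v : V} (h : ∀ w, D.omega v w = 0) : v = 0 :=
  D.symplectic.nondegenerate.1 v h

theorem swap (x y z : V) : D.nabla x (D.nabla' y z) = D.nabla y (D.nabla' x z) :=
  LinearMap.congr_fun (D.compatible x y) z

theorem swap_last (x y z : V) : D.nabla x (D.nabla' y z) = D.nabla x (D.nabla' z y) := by
  rw [D.affine'.torsion_free y z]

theorem nabla_nabla (x y z : V) : D.nabla x (D.nabla y z) = 0 := by
  apply D.eq_zero_of_omega
  intro w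
  have hc : ∀ x y z, D.nabla x (D.nabla y z) = D.nabla y (D.nabla x z) :=
    fun x y z => LinearMap.congr_fun (D.affine.comm x y) z
  have h1 : ∀ x y z w, D.omega (D.nabla x (D.nabla y z)) w
      = -D.omega (D.nabla x (D.nabla w z)) y := by
    intro x y z w
    rw [D.compat x, D.symplectic.skew, D.affine.torsion_free y z, D.compat z, hc z x,
      D.affine.torsion_free z w]
  have h2 : ∀ x y z w, D.omega (D.nabla x (D.nabla y z)) w
      = D.omega (D.nabla y (D.nabla x z)) w := by
    intro x y z w
    rw [hc]
  have h3 : ∀ x y z w, D.omega (D.nabla x (D.nabla y z)) w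
      = D.omega (D.nabla x (D.nabla z y)) w := by
    intro x y z w
    rw [D.affine.torsion_free y z]
  have e1 := h1 x y z w
  have e2 := h1 x w y z
  have e3 := h1 x z w y
  rw [h3 x z w y] at e3
  rw [h3 x w y z] at e2
  rw [h3 x y z w] at e1
  have f1 := h3 x y z w
  have f2 := h3 x w z y
  have f3 := h3 x y w z
  linarith

theorem nabla'_nabla' (x y z : V) : D.nabla' x (D.nabla' y z) = 0 := by
  apply D.eq_zero_of_omega
  intro w
  have hc : ∀ x y z, D.nabla' x (D.nabla' y z) = D.nabla' y (D.nabla' x z) :=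
    fun x y z => LinearMap.congr_fun (D.affine'.comm x y) z
  have h1 : ∀ x y z w, D.omega (D.nabla' x (D.nabla' y z)) w
      = -D.omega (D.nabla' x (D.nabla' w z)) y := by
    intro x y z w
    rw [D.compat' x, D.symplectic.skew, D.affine'.torsion_free y z, D.compat' z, hc z x,
      D.affine'.torsion_free z w]
  have h3 : ∀ x y z w, D.omega (D.nabla' x (D.nabla' y z)) w
      = D.omega (D.nabla' x (D.nabla' z y)) w := by
    intro x y z w
    rw [D.affine'.torsion_free y z]
  have e1 := h1 x y z w
  have e2 := h1 x w y z
  have e3 := h1 x z w y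
  rw [h3 x z w y] at e3
  rw [h3 x w y z] at e2
  rw [h3 x y z w] at e1
  have f1 := h3 x y z w
  have f2 := h3 x w z y
  have f3 := h3 x y w z
  linarith

theorem nabla'_nabla (x y z : V) : D.nabla' x (D.nabla y z) = -D.nabla x (D.nabla' y z) := by
  have hFG : ∀ x y z w, D.omega (D.nabla' y (D.nabla x w)) z
      = -D.omega (D.nabla x (D.nabla' y z)) w := by
    intro x y z w
    rw [D.compat x, D.symplectic.skew (D.nabla x w), D.compat' y, neg_neg]
  have hs : ∀ x y z w, D.omega (D.nabla x (D.nabla' y z)) w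
      = D.omega (D.nabla y (D.nabla' x z)) w := fun x y z w => by rw [D.swap]
  have hl : ∀ x y z w, D.omega (D.nabla x (D.nabla' y z)) w
      = D.omega (D.nabla x (D.nabla' z y)) w := fun x y z w => by rw [D.swap_last]
  have hG : ∀ x y z w, D.omega (D.nabla' y (D.nabla x w)) z
      = D.omega (D.nabla' y (D.nabla w x)) z := fun x y z w => by rw [D.affine.torsion_free]
  have key : ∀ x y z w, D.omega (D.nabla x (D.nabla' y z)) w
      = D.omega (D.nabla w (D.nabla' y z)) x := by
    intro x y z w
    have e1 := hFG x y z w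
    have e2 := hFG w y z x
    have e3 := hG x y z w
    linarith
  rw [← sub_eq_zero, sub_neg_eq_add]
  apply D.eq_zero_of_omega
  intro w
  rw [map_add, LinearMap.add_apply, hFG, hs x y z w, hl y x z w, hs y z x w, key z y x w,
    hs w y x z, hl y w x z]
  ring

theorem nabla_nabla_left (x y z : V) : D.nabla (D.nabla x y) z = 0 := by
  rw [D.affine.torsion_free, D.nabla_nabla]

theorem nabla'_nabla'_left (x y z : V) : D.nabla' (D.nabla' x y) z = 0 := by
  rw [D.affine'.torsion_free, D.nabla'_nabla']

theorem nabla'_nabla_left (x y z : V) :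
    D.nabla' (D.nabla x y) z = -D.nabla z (D.nabla' x y) := by
  rw [D.affine'.torsion_free, D.nabla'_nabla]

/-! ### The group `N_{∇,∇'}` -/

/-- `α(x', y) = y + ∇'_y x' - (1/2) ∇'_y ∇_y x'`. -/
def alpha (x' y : V) : V :=
  y + D.nabla' y x' - (1 / 2 : ℝ) • D.nabla' y (D.nabla y x')

/-- `β(x', y) = x' - ∇_{x'} y - (1/2) ∇_{x'} ∇'_{x'} y`. -/
def beta (x' y : V) : V :=
  x' - D.nabla x' y - (1 / 2 : ℝ) • D.nabla x' (D.nabla' x' y)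

/-- The underlying manifold `V × V` of the group `N_{∇,∇'}`. -/
def N (_D : AffineSymplecticPair V) : Type _ := V × V

instance : Mul D.N where
  mul p q := (p.1 + D.alpha p.2 q.1, D.beta p.2 q.1 + q.2)

instance : One D.N where
  one := (0, 0)

instance : Inv D.N where
  inv p := (D.alpha (-p.2) (-p.1), D.beta (-p.2) (-p.1))

theorem mul_fst (p q : D.N) : (p * q).1 = p.1 + D.alpha p.2 q.1 := rfl

theorem mul_snd (p q : D.N) : (p * q).2 = D.beta p.2 q.1 + q.2 := rfl

theorem inv_fst (p : D.N) : (p⁻¹).1 = D.alpha (-p.2) (-p.1) := rfl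

theorem inv_snd (p : D.N) : (p⁻¹).2 = D.beta (-p.2) (-p.1) := rfl

theorem one_fst : (1 : D.N).1 = 0 := rfl

theorem one_snd : (1 : D.N).2 = 0 := rfl

theorem nabla_nabla'_nabla' (x y u v : V) :
    D.nabla (D.nabla' x y) (D.nabla' u v) = 0 := by
  rw [D.swap, D.nabla'_nabla'_left, map_zero]

set_option linter.unusedSimpArgs false in
/-- The group `N_{∇,∇'}`. -/
instance : Group D.N :=
  Group.ofLeftAxioms
    (by
      intro p q r
      refine Prod.ext ?_ ?_
      · simp only [mul_fst, mul_snd, inv_fst, inv_snd, one_fst, one_snd, alpha, beta, map_add,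
          map_sub, map_smul, map_neg, map_zero, LinearMap.add_apply, LinearMap.sub_apply,
          LinearMap.smul_apply, LinearMap.neg_apply, LinearMap.zero_apply, nabla_nabla,
          nabla'_nabla', nabla'_nabla, nabla_nabla_left, nabla'_nabla'_left, nabla'_nabla_left,
          nabla_nabla'_nabla', smul_zero, neg_zero, sub_zero, add_zero, zero_add]
        rw [D.swap_last r.1 p.2 q.1, D.swap q.1 r.1 p.2]
        module
      · simp only [mul_fst, mul_snd, inv_fst, inv_snd, one_fst, one_snd, alpha, beta, map_add,
          map_sub, map_smul, map_neg, map_zero, LinearMap.add_apply, LinearMap.sub_apply,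
          LinearMap.smul_apply, LinearMap.neg_apply, LinearMap.zero_apply, nabla_nabla,
          nabla'_nabla', nabla'_nabla, nabla_nabla_left, nabla'_nabla'_left, nabla'_nabla_left,
          nabla_nabla'_nabla', smul_zero, neg_zero, sub_zero, add_zero, zero_add]
        rw [D.swap_last p.2 r.1 q.2, D.swap q.2 p.2 r.1]
        module)
    (by
      intro p
      refine Prod.ext ?_ ?_ <;> simp [mul_fst, mul_snd, one_fst, one_snd, alpha, beta])
    (by
      intro p
      refine Prod.ext ?_ ?_
      · simp only [mul_fst, mul_snd, inv_fst, inv_snd, one_fst, one_snd, alpha, beta, map_add,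
          map_sub, map_smul, map_neg, map_zero, LinearMap.add_apply, LinearMap.sub_apply,
          LinearMap.smul_apply, LinearMap.neg_apply, LinearMap.zero_apply, nabla_nabla,
          nabla'_nabla', nabla'_nabla, nabla_nabla_left, nabla'_nabla'_left, nabla'_nabla_left,
          nabla_nabla'_nabla', smul_zero, neg_zero, sub_zero, add_zero, zero_add]
        rw [D.swap_last p.1 p.2 p.1]
        module
      · simp only [mul_fst, mul_snd, inv_fst, inv_snd, one_fst, one_snd, alpha, beta, map_add,
          map_sub, map_smul, map_neg, map_zero, LinearMap.add_apply, LinearMap.sub_apply,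
          LinearMap.smul_apply, LinearMap.neg_apply, LinearMap.zero_apply, nabla_nabla,
          nabla'_nabla', nabla'_nabla, nabla_nabla_left, nabla'_nabla'_left, nabla'_nabla_left,
          nabla_nabla'_nabla', smul_zero, neg_zero, sub_zero, add_zero, zero_add]
        module)

end AffineSymplecticPair
end AffineSymplectic

section LieGroupStructure

variable {V : Type*} [NormedAddCommGroup V] [NormedSpace ℝ V] [FiniteDimensional ℝ V]

namespace AffineSymplecticPair

variable (D : AffineSymplecticPair V)

/-- The manifold underlying `N_{∇,∇'}` is the vector space `V × V`. -/
instance : NormedAddCommGroup D.N := inferInstanceAs (NormedAddCommGroup (V × V))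

instance : NormedSpace ℝ D.N := inferInstanceAs (NormedSpace ℝ (V × V))

instance : FiniteDimensional ℝ D.N := inferInstanceAs (FiniteDimensional ℝ (V × V))

theorem contDiff_bilin {F : Type*} [NormedAddCommGroup F] [NormedSpace ℝ F]
    (B : V →ₗ[ℝ] V →ₗ[ℝ] V) {f g : F → V} (hf : ContDiff ℝ ω f) (hg : ContDiff ℝ ω g) :
    ContDiff ℝ ω fun p => B (f p) (g p) := by
  have h : ContDiff ℝ ω fun x => LinearMap.toContinuousLinearMap (B x) :=
    (LinearMap.toContinuousLinearMap
      ((LinearMap.toContinuousLinearMap (E := V) (F' := V)).toLinearMap ∘ₗ B)).contDiff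
  exact (h.comp hf).clm_apply hg

theorem contDiff_alpha {F : Type*} [NormedAddCommGroup F] [NormedSpace ℝ F]
    {f g : F → V} (hf : ContDiff ℝ ω f) (hg : ContDiff ℝ ω g) :
    ContDiff ℝ ω fun p => D.alpha (f p) (g p) :=
  (hg.add (contDiff_bilin D.nabla' hg hf)).sub
    ((contDiff_bilin D.nabla' hg (contDiff_bilin D.nabla hg hf)).const_smul _)

theorem contDiff_beta {F : Type*} [NormedAddCommGroup F] [NormedSpace ℝ F]
    {f g : F → V} (hf : ContDiff ℝ ω f) (hg : ContDiff ℝ ω g) :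
    ContDiff ℝ ω fun p => D.beta (f p) (g p) :=
  (hf.sub (contDiff_bilin D.nabla hf hg)).sub
    ((contDiff_bilin D.nabla hf (contDiff_bilin D.nabla' hf hg)).const_smul _)

theorem contDiff_mul : ContDiff ℝ ω fun p : D.N × D.N => p.1 * p.2 := by
  have h : ContDiff ℝ ω fun p : (V × V) × (V × V) =>
      (p.1.1 + D.alpha p.1.2 p.2.1, D.beta p.1.2 p.2.1 + p.2.2) :=
    ContDiff.prodMk
      (contDiff_fst.fst.add (D.contDiff_alpha contDiff_fst.snd contDiff_snd.fst))
      ((D.contDiff_beta contDiff_fst.snd contDiff_snd.fst).add contDiff_snd.snd)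
  exact h

theorem contDiff_inv : ContDiff ℝ ω fun p : D.N => p⁻¹ := by
  have h : ContDiff ℝ ω fun p : V × V => (D.alpha (-p.2) (-p.1), D.beta (-p.2) (-p.1)) :=
    ContDiff.prodMk (D.contDiff_alpha contDiff_snd.neg contDiff_fst.neg)
      (D.contDiff_beta contDiff_snd.neg contDiff_fst.neg)
  exact h

/-- `N_{∇,∇'}` is a Lie group. -/
instance (n : ℕ∞ω) : LieGroup 𝓘(ℝ, D.N) n D.N where
  contMDiff_mul := by
    rw [← modelWithCornersSelf_prod, chartedSpaceSelf_prod]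
    exact D.contDiff_mul.contMDiff.of_le le_top
  contMDiff_inv := D.contDiff_inv.contMDiff.of_le le_top

end AffineSymplecticPair
end LieGroupStructure

/-! ### Pseudo-Riemannian geometry, in local coordinates

`E` is a finite-dimensional real vector space. The definitions whose names start with `coord`
concern tensor fields given on (an open subset of) `E`; those on a manifold `M` modelled on `E`
are evaluated in the charts `chartAt E x₀` of `M`. -/

section Geometry

variable {E : Type*} [NormedAddCommGroup E] [NormedSpace ℝ E]

/-- The Koszul functional
`w ↦ (1/2) (D_u h (v, w) + D_v h (u, w) - D_w h (u, v))` of a metric `h` at `y`. -/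
def coordKoszul (h : E → E →L[ℝ] E →L[ℝ] ℝ) (y u v : E) : E →L[ℝ] ℝ :=
  (1 / 2 : ℝ) •
    (fderiv ℝ h y u v + fderiv ℝ h y v u - ((fderiv ℝ h y).flip u).flip v)

theorem coordKoszul_apply (h : E → E →L[ℝ] E →L[ℝ] ℝ) (y u v w : E) :
    coordKoszul h y u v w =
      (1 / 2 : ℝ) * (fderiv ℝ h y u v w + fderiv ℝ h y v u w - fderiv ℝ h y w u v) := by
  simp [coordKoszul]

/-- The Christoffel symbols `Γ_y(u, v)` of `h`: the solution of
`h_y(Γ_y(u, v), w) = (1/2) (D_u h (v, w) + D_v h (u, w) - D_w h (u, v))` for all `w`. -/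
def coordChristoffel (h : E → E →L[ℝ] E →L[ℝ] ℝ) (y u v : E) : E :=
  (h y).inverse (coordKoszul h y u v)

/-- The curvature `R_y(u, v) w` of the Levi-Civita connection of `h`, for
`R(X, Y) = ∇_X ∇_Y - ∇_Y ∇_X - ∇_[X, Y]`. -/
def coordCurvature (h : E → E →L[ℝ] E →L[ℝ] ℝ) (y u v w : E) : E :=
  fderiv ℝ (fun z => coordChristoffel h z v w) y u
    - fderiv ℝ (fun z => coordChristoffel h z u w) y v
    + coordChristoffel h y u (coordChristoffel h y v w)
    - coordChristoffel h y v (coordChristoffel h y u w)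

/-- The Ricci tensor `Ric_y(v, w)`: the trace of `u ↦ R_y(u, v) w`. -/
def coordRicci [FiniteDimensional ℝ E] (h : E → E →L[ℝ] E →L[ℝ] ℝ) (y v w : E) : ℝ :=
  ∑ i, (Module.finBasis ℝ E).coord i (coordCurvature h y (Module.finBasis ℝ E i) v w)

variable (E) (M : Type*) [TopologicalSpace M] [ChartedSpace E M]

/-- A field of bilinear forms on the tangent spaces of `M`. -/
abbrev BilinField : Type _ :=
  ∀ x : M, TangentSpace 𝓘(ℝ, E) x →L[ℝ] TangentSpace 𝓘(ℝ, E) x →L[ℝ] ℝ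

/-- A field of endomorphisms of the tangent spaces of `M`. -/
abbrev EndoField : Type _ :=
  ∀ x : M, TangentSpace 𝓘(ℝ, E) x →L[ℝ] TangentSpace 𝓘(ℝ, E) x

variable {E M}

/-- The derivative at `y` of the inverse of the chart `chartAt E x₀`, whose columns are the
coordinate vector fields of the chart. -/
def chartFrame (x₀ : M) (y : E) : E →L[ℝ] TangentSpace 𝓘(ℝ, E) ((chartAt E x₀).symm y) :=
  mfderiv 𝓘(ℝ, E) 𝓘(ℝ, E) (chartAt E x₀).symm y

/-- The derivative of the chart `chartAt E x₀` at the point with coordinates `y`. -/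
def chartCoframe (x₀ : M) (y : E) : TangentSpace 𝓘(ℝ, E) ((chartAt E x₀).symm y) →L[ℝ] E :=
  mfderiv 𝓘(ℝ, E) 𝓘(ℝ, E) (chartAt E x₀) ((chartAt E x₀).symm y)

/-- The field of bilinear forms `g` in the coordinates of the chart `chartAt E x₀`. -/
def BilinField.inChart (g : BilinField E M) (x₀ : M) (y : E) : E →L[ℝ] E →L[ℝ] ℝ :=
  ContinuousLinearMap.bilinearComp (E := E) (F := E)
    (g ((chartAt E x₀).symm y)) (chartFrame x₀ y) (chartFrame x₀ y)

/-- The field of endomorphisms `J` in the coordinates of the chart `chartAt E x₀`. -/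
def EndoField.inChart (J : EndoField E M) (x₀ : M) (y : E) : E →L[ℝ] E :=
  chartCoframe x₀ y ∘L J ((chartAt E x₀).symm y) ∘L chartFrame x₀ y

def BilinField.IsSmooth (g : BilinField E M) : Prop :=
  ∀ x₀ : M, ContDiffOn ℝ ∞ (g.inChart x₀) (chartAt E x₀).target

def EndoField.IsSmooth (J : EndoField E M) : Prop :=
  ∀ x₀ : M, ContDiffOn ℝ ∞ (J.inChart x₀) (chartAt E x₀).target

/-- The quadratic form of a bilinear form on a tangent space. -/
def BilinField.quadraticForm (g : BilinField E M) (x : M) :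
    QuadraticForm ℝ (TangentSpace 𝓘(ℝ, E) x) :=
  LinearMap.BilinMap.toQuadraticMap (g x).toLinearMap₁₂

/-- `g` is a pseudo-Riemannian metric of neutral signature `(m, m)`, where `2 m = dim M`. -/
structure BilinField.IsNeutralMetric (g : BilinField E M) : Prop where
  smooth : g.IsSmooth
  symm : ∀ x u v, g x u v = g x v u
  nondegenerate : ∀ x u, (∀ v, g x u v = 0) → u = 0
  sigPos : ∀ x, 2 * sigPos (g.quadraticForm x) = Module.finrank ℝ E
  sigNeg : ∀ x, 2 * sigNeg (g.quadraticForm x) = Module.finrank ℝ E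

/-- `w` is a closed differential 2-form. -/
def BilinField.IsClosedTwoForm (w : BilinField E M) : Prop :=
  w.IsSmooth ∧ ∀ x₀ : M, ∃ Ω : E → E [⋀^Fin 2]→L[ℝ] ℝ, ∀ y ∈ (chartAt E x₀).target,
    (∀ u v, Ω y ![u, v] = w.inChart x₀ y u v) ∧ extDeriv Ω y = 0

/-- The field `(u, v) ↦ g (J u, v)`. -/
def BilinField.comp (g : BilinField E M) (J : EndoField E M) : BilinField E M :=
  fun x => g x ∘L J x

/-- `(J, P, g)` is a hypersymplectic structure. -/
structure IsHypersymplectic (g : BilinField E M) (J P : EndoField E M) : Prop where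
  metric : g.IsNeutralMetric
  smooth_J : J.IsSmooth
  smooth_P : P.IsSmooth
  J_sq : ∀ x u, J x (J x u) = -u
  P_sq : ∀ x u, P x (P x u) = u
  anticomm : ∀ x u, J x (P x u) = -P x (J x u)
  metric_J : ∀ x u v, g x (J x u) (J x v) = g x u v
  metric_P : ∀ x u v, g x (P x u) (P x v) = -g x u v
  closed₁ : (g.comp J).IsClosedTwoForm
  closed₂ : (g.comp P).IsClosedTwoForm
  closed₃ : (g.comp fun x => J x ∘L P x).IsClosedTwoForm

/-- The almost complex structure `J` is integrable: its Nijenhuis tensor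
`[J X, J Y] - J [J X, Y] - J [X, J Y] - [X, Y]` vanishes. -/
def EndoField.IsIntegrable (J : EndoField E M) : Prop :=
  ∀ x₀ : M, ∀ X Y : E → E, ContDiffOn ℝ ∞ X (chartAt E x₀).target →
    ContDiffOn ℝ ∞ Y (chartAt E x₀).target → ∀ y ∈ (chartAt E x₀).target,
    VectorField.lieBracket ℝ (fun z => J.inChart x₀ z (X z)) (fun z => J.inChart x₀ z (Y z)) y
      - J.inChart x₀ y (VectorField.lieBracket ℝ (fun z => J.inChart x₀ z (X z)) Y y)
      - J.inChart x₀ y (VectorField.lieBracket ℝ X (fun z => J.inChart x₀ z (Y z)) y)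
      - VectorField.lieBracket ℝ X Y y = 0

/-- `(J, g)` is a neutral Kähler structure: `J` is a complex structure, the neutral metric `g` is
Hermitian, and the Kähler form `g (J ·, ·)` is closed. -/
structure IsNeutralKahler (g : BilinField E M) (J : EndoField E M) : Prop where
  metric : g.IsNeutralMetric
  smooth_J : J.IsSmooth
  J_sq : ∀ x u, J x (J x u) = -u
  integrable : J.IsIntegrable
  hermitian : ∀ x u v, g x (J x u) (J x v) = g x u v
  closed : (g.comp J).IsClosedTwoForm

def BilinField.IsFlat (g : BilinField E M) : Prop :=
  ∀ x₀ : M, ∀ y ∈ (chartAt E x₀).target, ∀ u v w, coordCurvature (g.inChart x₀) y u v w = 0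

def BilinField.IsRicciFlat [FiniteDimensional ℝ E] (g : BilinField E M) : Prop :=
  ∀ x₀ : M, ∀ y ∈ (chartAt E x₀).target, ∀ v w, coordRicci (g.inChart x₀) y v w = 0

/-- `γ : ℝ → M` is a geodesic of the Levi-Civita connection of `g`: in the chart around `γ t`, the
coordinate curve `c` satisfies `c'' + Γ_c(c', c') = 0` at `t`. -/
def BilinField.IsGeodesic (g : BilinField E M) (γ : ℝ → M) : Prop :=
  ContMDiff 𝓘(ℝ, ℝ) 𝓘(ℝ, E) ∞ γ ∧
    ∀ t, deriv (deriv (chartAt E (γ t) ∘ γ)) t +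
      coordChristoffel (g.inChart (γ t)) (chartAt E (γ t) (γ t))
        (deriv (chartAt E (γ t) ∘ γ) t) (deriv (chartAt E (γ t) ∘ γ) t) = 0

/-- Geodesic completeness: every initial position `x` and every initial velocity (with coordinates
`v` in the chart around `x`) belongs to a geodesic which is defined on all of `ℝ`. -/
def BilinField.IsComplete (g : BilinField E M) : Prop :=
  ∀ (x : M) (v : E), ∃ γ : ℝ → M, g.IsGeodesic γ ∧ γ 0 = x ∧ deriv (chartAt E x ∘ γ) 0 = v

/-- `(g', J', P')` on `M'` is induced by `(g, J, P)` on `M` through the map `π : M → M'`: `g` is the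
pull-back of `g'`, and `dπ` intertwines `J` with `J'` and `P` with `P'`. -/
structure IsInducedThrough {M' : Type*} [TopologicalSpace M'] [ChartedSpace E M'] (π : M → M')
    (g : BilinField E M) (J P : EndoField E M) (g' : BilinField E M') (J' P' : EndoField E M') :
    Prop where
  metric : ∀ x u v, g' (π x) (mfderiv 𝓘(ℝ, E) 𝓘(ℝ, E) π x u) (mfderiv 𝓘(ℝ, E) 𝓘(ℝ, E) π x v)
    = g x u v
  map_J : ∀ x u, J' (π x) (mfderiv 𝓘(ℝ, E) 𝓘(ℝ, E) π x u)
    = mfderiv 𝓘(ℝ, E) 𝓘(ℝ, E) π x (J x u)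
  map_P : ∀ x u, P' (π x) (mfderiv 𝓘(ℝ, E) 𝓘(ℝ, E) π x u)
    = mfderiv 𝓘(ℝ, E) 𝓘(ℝ, E) π x (P x u)

end Geometry

/-! ### The left-invariant hypersymplectic structure of `N_{∇,∇'}` -/

section LeftInvariant

variable {V : Type*} [NormedAddCommGroup V] [NormedSpace ℝ V] [FiniteDimensional ℝ V]

namespace AffineSymplecticPair

variable (D : AffineSymplecticPair V)

/-- The derivative at `1` of the left translation by `p`. -/
def leftDeriv (p : D.N) : D.N →L[ℝ] D.N := fderiv ℝ (fun q : D.N => p * q) 1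

/-- The left-invariant Maurer-Cartan form: the derivative at `p` of the left translation by
`p⁻¹`. -/
def maurerCartan (p : D.N) : D.N →L[ℝ] D.N := fderiv ℝ (fun q : D.N => p⁻¹ * q) p

/-- `ω`, as a continuous bilinear map. -/
def omegaL : V →L[ℝ] V →L[ℝ] ℝ :=
  LinearMap.toContinuousLinearMap
    ((LinearMap.toContinuousLinearMap (E := V) (F' := ℝ)).toLinearMap ∘ₗ D.omega)

/-- The inner product `((x, x'), (y, y')) ↦ -ω(x, y') + ω(x', y)` at the identity. -/
def metricOne : (V × V) →L[ℝ] (V × V) →L[ℝ] ℝ :=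
  -D.omegaL.bilinearComp (ContinuousLinearMap.fst ℝ V V) (ContinuousLinearMap.snd ℝ V V)
    + D.omegaL.bilinearComp (ContinuousLinearMap.snd ℝ V V) (ContinuousLinearMap.fst ℝ V V)

/-- `J (x, y) = (-y, x)` at the identity. -/
def JOne : (V × V) →L[ℝ] (V × V) :=
  (-ContinuousLinearMap.snd ℝ V V).prod (ContinuousLinearMap.fst ℝ V V)

/-- `E (x, y) = (x, -y)` at the identity. -/
def EOne : (V × V) →L[ℝ] (V × V) :=
  (ContinuousLinearMap.fst ℝ V V).prod (-ContinuousLinearMap.snd ℝ V V)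

/-- The left-invariant metric of `N_{∇,∇'}`. -/
def metric : BilinField D.N D.N := fun p =>
  ContinuousLinearMap.bilinearComp (E := D.N) (F := D.N) D.metricOne
    (D.maurerCartan p) (D.maurerCartan p)

/-- The left-invariant almost complex structure of `N_{∇,∇'}`. -/
def J : EndoField D.N D.N := fun p =>
  ContinuousLinearMap.comp (M₁ := D.N) (M₂ := D.N) (M₃ := D.N) (D.leftDeriv p)
    (ContinuousLinearMap.comp (M₁ := D.N) (M₂ := D.N) (M₃ := D.N) (JOne (V := V))
      (D.maurerCartan p))

/-- The left-invariant almost product structure of `N_{∇,∇'}`. -/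
def E : EndoField D.N D.N := fun p =>
  ContinuousLinearMap.comp (M₁ := D.N) (M₂ := D.N) (M₃ := D.N) (D.leftDeriv p)
    (ContinuousLinearMap.comp (M₁ := D.N) (M₂ := D.N) (M₃ := D.N) (EOne (V := V))
      (D.maurerCartan p))

end AffineSymplecticPair
end LeftInvariant

/-! ### The three-parameter family on `ℝ⁴` -/

section Example

/-- The bilinear map `(x, y) ↦ ∑ j, x_j A_j y`, that is, `∇` with `∇_{e_j} = A_j`. -/
def connectionOfMatrices (A : Fin 4 → Matrix (Fin 4) (Fin 4) ℝ) :
    (Fin 4 → ℝ) →ₗ[ℝ] (Fin 4 → ℝ) →ₗ[ℝ] (Fin 4 → ℝ) :=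
  ∑ j, (LinearMap.proj j).smulRight (Matrix.toLin' (A j))

/-- `ω = e¹ ∧ e² + e³ ∧ e⁴`. -/
def omega₄ : LinearMap.BilinForm ℝ (Fin 4 → ℝ) :=
  LinearMap.mk₂ ℝ (fun x y => x 0 * y 1 - x 1 * y 0 + (x 2 * y 3 - x 3 * y 2))
    (by intros; simp; ring) (by intros; simp; ring)
    (by intros; simp; ring) (by intros; simp; ring)

/-- The affine structure `∇`. -/
def nabla₄ : (Fin 4 → ℝ) →ₗ[ℝ] (Fin 4 → ℝ) →ₗ[ℝ] (Fin 4 → ℝ) :=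
  connectionOfMatrices
    ![!![ 1,  0,  1, 0;
          0, -1,  0, 1;
         -1,  0, -1, 0;
          0, -1,  0, 1],
      !![ 0, 0,  0, 0;
         -1, 0, -1, 0;
          0, 0,  0, 0;
         -1, 0, -1, 0],
      !![ 1,  0,  1, 0;
          0, -1,  0, 1;
         -1,  0, -1, 0;
          0, -1,  0, 1],
      !![ 0, 0, 0, 0;
          1, 0, 1, 0;
          0, 0, 0, 0;
          1, 0, 1, 0]]

/-- The affine structure `∇'_{a,b,c}`. -/
def nabla₄' (a b c : ℝ) : (Fin 4 → ℝ) →ₗ[ℝ] (Fin 4 → ℝ) →ₗ[ℝ] (Fin 4 → ℝ) :=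
  connectionOfMatrices
    ![!![ a,  0,          a, 0;
          b, -a,          c, a;
         -a,  0,         -a, 0;
          c, -a, -b + 2 * c, a],
      !![ 0, 0,  0, 0;
         -a, 0, -a, 0;
          0, 0,  0, 0;
         -a, 0, -a, 0],
      !![         a,  0,              a, 0;
                  c, -a,     -b + 2 * c, a;
                 -a,  0,             -a, 0;
         -b + 2 * c, -a, -2 * b + 3 * c, a],
      !![ 0, 0, 0, 0;
          a, 0, a, 0;
          0, 0, 0, 0;
          a, 0, a, 0]]

theorem nabla₄_apply (x y : Fin 4 → ℝ) :
    nabla₄ x y =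
      ![(x 0 + x 2) * (y 0 + y 2),
        (x 0 + x 2) * (y 3 - y 1) + (x 3 - x 1) * (y 0 + y 2),
        -((x 0 + x 2) * (y 0 + y 2)),
        (x 0 + x 2) * (y 3 - y 1) + (x 3 - x 1) * (y 0 + y 2)] := by
  ext i
  fin_cases i <;>
    simp [nabla₄, connectionOfMatrices, Fin.sum_univ_four, dotProduct] <;> ring

theorem nabla₄'_apply (a b c : ℝ) (x y : Fin 4 → ℝ) :
    nabla₄' a b c x y =
      ![a * (x 0 + x 2) * (y 0 + y 2),
        a * ((x 0 + x 2) * (y 3 - y 1) + (x 3 - x 1) * (y 0 + y 2))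
          + b * (x 0 * y 0) + c * (x 0 * y 2 + x 2 * y 0) + (-b + 2 * c) * (x 2 * y 2),
        -(a * (x 0 + x 2) * (y 0 + y 2)),
        a * ((x 0 + x 2) * (y 3 - y 1) + (x 3 - x 1) * (y 0 + y 2))
          + c * (x 0 * y 0) + (-b + 2 * c) * (x 0 * y 2 + x 2 * y 0)
          + (-2 * b + 3 * c) * (x 2 * y 2)] := by
  ext i
  fin_cases i <;>
    simp [nabla₄', connectionOfMatrices, Fin.sum_univ_four, dotProduct] <;> ring

theorem omega₄_apply (x y : Fin 4 → ℝ) :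
    omega₄ x y = x 0 * y 1 - x 1 * y 0 + (x 2 * y 3 - x 3 * y 2) := rfl

theorem isSymplecticForm_omega₄ : IsSymplecticForm omega₄ where
  skew x y := by simp only [omega₄_apply]; ring
  nondegenerate := by
    have h : ∀ x : Fin 4 → ℝ, (∀ y, omega₄ x y = 0) → x = 0 := by
      intro x hx
      have h0 := hx (Pi.single 0 1)
      have h1 := hx (Pi.single 1 1)
      have h2 := hx (Pi.single 2 1)
      have h3 := hx (Pi.single 3 1)
      simp [omega₄_apply] at h0 h1 h2 h3
      ext i
      fin_cases i <;> simp [*]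
    refine ⟨h, fun y hy => h y fun x => ?_⟩
    have := hy x
    simp only [omega₄_apply] at this ⊢
    linarith

theorem isAffineStructure_nabla₄ : IsAffineStructure nabla₄ where
  torsion_free x y := by
    simp only [nabla₄_apply]
    ext i
    fin_cases i <;> simp <;> ring
  comm x y := by
    ext1 i
    ext j
    fin_cases j <;> simp [nabla₄_apply]

theorem isAffineStructure_nabla₄' (a b c : ℝ) : IsAffineStructure (nabla₄' a b c) where
  torsion_free x y := by
    simp only [nabla₄'_apply]
    ext i
    fin_cases i <;> simp <;> ring
  comm x y := by
    apply LinearMap.ext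
    intro z
    ext j
    fin_cases j <;> simp [nabla₄'_apply] <;> ring

theorem isCompatibleWith_nabla₄ : IsCompatibleWith nabla₄ omega₄ := by
  intro x y z
  simp [nabla₄_apply, omega₄_apply]
  ring

theorem isCompatibleWith_nabla₄' (a b c : ℝ) : IsCompatibleWith (nabla₄' a b c) omega₄ := by
  intro x y z
  simp [nabla₄'_apply, omega₄_apply]
  ring

theorem areCompatible_nabla₄ (a b c : ℝ) : AreCompatible nabla₄ (nabla₄' a b c) := by
  intro x y
  apply LinearMap.ext
  intro z
  ext j
  fin_cases j <;> simp [nabla₄_apply, nabla₄'_apply] <;> ring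

/-- The data `(∇, ∇'_{a,b,c}, ω)` on `ℝ⁴`. -/
def pair₄ (a b c : ℝ) : AffineSymplecticPair (Fin 4 → ℝ) where
  omega := omega₄
  nabla := nabla₄
  nabla' := nabla₄' a b c
  symplectic := isSymplecticForm_omega₄
  affine := isAffineStructure_nabla₄
  affine' := isAffineStructure_nabla₄' a b c
  compat := isCompatibleWith_nabla₄
  compat' := isCompatibleWith_nabla₄' a b c
  compatible := areCompatible_nabla₄ a b c

/-- The group `N_{∇,∇'}` of the data `(∇, ∇'_{a,b,c}, ω)`; its underlying manifold is `ℝ⁴ × ℝ⁴`. -/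
abbrev N₄ (a b c : ℝ) : Type := (pair₄ a b c).N

/-- The map `α` of the group law in coordinates. -/
def alpha₄ (a b c : ℝ) (x' y : Fin 4 → ℝ) : Fin 4 → ℝ :=
  ![y 0 + a * (y 0 + y 2) * (x' 0 + x' 2),
    y 1 + (b * y 0 - a * y 1 + c * y 2 + a * y 3) * x' 0 - a * (y 0 + y 2) * x' 1
      + (c * y 0 - a * y 1 + (-b + 2 * c) * y 2 + a * y 3) * x' 2
      + a * (y 0 + y 2) * x' 3 + 1 / 2 * (-b + c) * (y 0 + y 2) ^ 2 * (x' 0 + x' 2),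
    y 2 - a * (y 0 + y 2) * (x' 0 + x' 2),
    y 3 + (c * y 0 - a * y 1 + (-b + 2 * c) * y 2 + a * y 3) * x' 0 - a * (y 0 + y 2) * x' 1
      + ((-b + 2 * c) * y 0 - a * y 1 + (-2 * b + 3 * c) * y 2 + a * y 3) * x' 2
      + a * (y 0 + y 2) * x' 3 + 1 / 2 * (-b + c) * (y 0 + y 2) ^ 2 * (x' 0 + x' 2)]

/-- The map `β` of the group law in coordinates. -/
def beta₄ (b c : ℝ) (x' y : Fin 4 → ℝ) : Fin 4 → ℝ :=
  ![x' 0 - (x' 0 + x' 2) * (y 0 + y 2),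
    x' 1 + (x' 1 - x' 3) * (y 0 + y 2) + (x' 0 + x' 2) * (y 1 - y 3)
      - 1 / 2 * (-b + c) * (x' 0 + x' 2) ^ 2 * (y 0 + y 2),
    x' 2 + (x' 0 + x' 2) * (y 0 + y 2),
    x' 3 + (x' 1 - x' 3) * (y 0 + y 2) + (x' 0 + x' 2) * (y 1 - y 3)
      - 1 / 2 * (-b + c) * (x' 0 + x' 2) ^ 2 * (y 0 + y 2)]

/-- The values of the left-invariant 1-forms `e¹, …, e⁴` at the point `(x, x')` on a tangent vector
with components `dx` and `dx'`. -/
def coframeE (a b c : ℝ) (x' dx : Fin 4 → ℝ) : Fin 4 → ℝ :=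
  ![(1 - a * (x' 0 + x' 2)) * dx 0 - a * (x' 0 + x' 2) * dx 2,
    (-b * x' 0 + a * x' 1 - c * x' 2 - a * x' 3) * dx 0 + (1 + a * (x' 0 + x' 2)) * dx 1
      + (-c * x' 0 + a * x' 1 - (-b + 2 * c) * x' 2 - a * x' 3) * dx 2
      - a * (x' 0 + x' 2) * dx 3,
    a * (x' 0 + x' 2) * dx 0 + (1 + a * (x' 0 + x' 2)) * dx 2,
    (-c * x' 0 + a * x' 1 - (-b + 2 * c) * x' 2 - a * x' 3) * dx 0 + a * (x' 0 + x' 2) * dx 1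
      + (-(-b + 2 * c) * x' 0 + a * x' 1 - (-2 * b + 3 * c) * x' 2 - a * x' 3) * dx 2
      + (1 - a * (x' 0 + x' 2)) * dx 3]

/-- The values of the left-invariant 1-forms `f¹, …, f⁴` at the point `(x, x')` on a tangent vector
with components `dx` and `dx'`. -/
def coframeF (b c : ℝ) (x' dx dx' : Fin 4 → ℝ) : Fin 4 → ℝ :=
  ![(x' 0 + x' 2) * dx 0 + (x' 0 + x' 2) * dx 2 + dx' 0,
    (-(1 / 2) * (-b + c) * (x' 0 + x' 2) ^ 2 - x' 1 + x' 3) * dx 0 - (x' 0 + x' 2) * dx 1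
      + (-(1 / 2) * (-b + c) * (x' 0 + x' 2) ^ 2 - x' 1 + x' 3) * dx 2
      + (x' 0 + x' 2) * dx 3 + dx' 1,
    -(x' 0 + x' 2) * dx 0 - (x' 0 + x' 2) * dx 2 + dx' 2,
    (-(1 / 2) * (-b + c) * (x' 0 + x' 2) ^ 2 - x' 1 + x' 3) * dx 0 - (x' 0 + x' 2) * dx 1
      + (-(1 / 2) * (-b + c) * (x' 0 + x' 2) ^ 2 - x' 1 + x' 3) * dx 2
      + (x' 0 + x' 2) * dx 3 + dx' 3]

/-- The space `ℝ⁸ = ℝ⁴ × ℝ⁴` with coordinates `x₁, …, x₄, x'₁, …, x'₄`. -/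
abbrev R8 : Type := (Fin 4 → ℝ) × (Fin 4 → ℝ)

/-- The 1-form `d x_i` (with indices starting at `0`). -/
def dX (i : Fin 4) : R8 →L[ℝ] ℝ := ContinuousLinearMap.proj i ∘L ContinuousLinearMap.fst ℝ _ _

/-- The 1-form `d x'_i` (with indices starting at `0`). -/
def dX' (i : Fin 4) : R8 →L[ℝ] ℝ := ContinuousLinearMap.proj i ∘L ContinuousLinearMap.snd ℝ _ _

/-- The symmetric product `φ ψ = φ ⊗ ψ + ψ ⊗ φ` of two covectors. -/
def symProd (φ ψ : R8 →L[ℝ] ℝ) : R8 →L[ℝ] R8 →L[ℝ] ℝ := φ.smulRight ψ + ψ.smulRight φ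

/-- The explicit metric on `ℝ⁸`, in coordinates. -/
def explicitMetricAt (p : R8) : R8 →L[ℝ] R8 →L[ℝ] ℝ :=
  let x' := p.2
  (-(3 / 2) * (x' 0 + x' 2) ^ 2 + x' 1 - x' 3) • symProd (dX 0 + dX 2) (dX 0 + dX 2)
    + (2 * (x' 0 + x' 2)) • symProd (dX 0 + dX 2) (dX 1 - dX 3)
    - x' 0 • symProd (dX 0) (dX' 0) - symProd (dX 0) (dX' 1) + symProd (dX 1) (dX' 0)
    + x' 2 • (symProd (dX 0) (dX' 2) + symProd (dX 2) (dX' 0))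
    + (x' 0 + 2 * x' 2) • symProd (dX 2) (dX' 2)
    - symProd (dX 2) (dX' 3) + symProd (dX 3) (dX' 2)

/-- The explicit metric, as a field of bilinear forms on the manifold `ℝ⁸`. -/
def explicitMetric : BilinField R8 R8 := fun p => explicitMetricAt p

end Example
end

/-!
Everything is proved for an arbitrary pair of affine structures `∇`, `∇'` on `V`, compatible with a
symplectic form and with each other; the family on `ℝ⁴` enters only through its structure constants,
through `∇ ≠ 0`, and in the construction of the lattices.

*Algebra.* The product of two of the operators `∇_x`, `∇'_x` is zero or, up to sign, a value of the
totally symmetric trilinear map `cubic x y z = ∇_x ∇'_y z`, and products of three of them vanish.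
Hence iterated brackets and commutators of length three are given by `cubic`, and those of length
four vanish (`lie_lie`, `lie_lie_lie`, `commutator_commutator_fst`,
`commutator_commutator_commutator`). As `∇ ≠ 0`, the nilpotency class is `2` or `3`, according to
whether `cubic` vanishes or not. For the family on `ℝ⁴`, `cubic` is `c - b` times a nonzero map
(`cubic_pair₄`).

*Geometry of the group.* In the left-invariant frame, the Levi-Civita connection of `g` has the
constant coefficients `(x, x'), (y, y') ↦ (∇_x y + ∇'_{x'} y, ∇_x y' + ∇'_{x'} y')`
(`connection`). This connection is torsion-free (`isTorsionFreeCoframe`), and `g`, `J` and `E` are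
parallel for it. Parallel 2-forms are closed
(`exists_extDeriv_coframeForm_eq_zero`), and parallel almost complex structures are integrable
(`nijenhuis_coframeEndo`). The curvature is a multiple of `cubic` (`frameCurvature_connection`), so
it vanishes exactly if `cubic` does. As `u ↦ R(u, v) w` has square zero, its trace is zero, which
is Ricci-flatness (`coordRicci_eq_zero`). The geodesics through the identity are polynomials of
degree at most three, and all geodesics are left translates of them (`geodesic_mul_geodesicOne`).

*Quotients.* Let `π : N → M` be a map which is locally inverse to the charts of `M`, where these
charts differ from each other by left translations (`IsLocalModel`). In every chart of `M`, the
tensor fields induced by `π` have the same expression as on `N`, so everything that was proved in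
coordinates on `N` holds on `M`. This applies to `M = N` and to the quotients `Γ \ N`
(`isLocalModel_proj`).

*Lattices.* If `d` is a common denominator of `a`, `b`, `c`, then `ℤ⁴ × (2d ℤ)⁴` is closed under
the group law. It is co-compact, because the coordinates of a point can be moved to a bounded set
one after the other (`exists_norm_add_alpha₄_le`).
-/

noncomputable section

/-! ### Torsion-free coframes with constant coefficients -/

section TorsionFreeCoframe

variable {E : Type*} [NormedAddCommGroup E] [NormedSpace ℝ E]

/-- A smooth coframe `m` on the vector space `E`, with dual frame `l`, such that the connection
which has the constant coefficients `B` in this frame is torsion-free. -/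
structure IsTorsionFreeCoframe (m l : E → E →L[ℝ] E) (B : E →L[ℝ] E →L[ℝ] E) : Prop where
  smooth : ContDiff ℝ ∞ m
  smooth_frame : ContDiff ℝ ∞ l
  frame_coframe : ∀ y v, l y (m y v) = v
  coframe_frame : ∀ y v, m y (l y v) = v
  torsion_free : ∀ y u v,
    fderiv ℝ m y u v + B (m y u) (m y v) = fderiv ℝ m y v u + B (m y v) (m y u)

/-- The Christoffel symbols of the connection with coefficients `B` in the coframe `m`. -/
def frameChristoffel (m l : E → E →L[ℝ] E) (B : E →L[ℝ] E →L[ℝ] E) (y u v : E) : E :=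
  l y (fderiv ℝ m y u v + B (m y u) (m y v))

/-- The curvature at the identity, `[B ξ, B η] - B [ξ, η]`, of the left-invariant connection with
coefficients `B`; the bracket is expressed through the vanishing of the torsion. -/
def frameCurvature (B : E →L[ℝ] E →L[ℝ] E) (ξ η ζ : E) : E :=
  B ξ (B η ζ) - B η (B ξ ζ) - B (B ξ η - B η ξ) ζ

/-- The field of bilinear forms with the constant coefficients `b` in the coframe `m`. -/
def coframeForm (m : E → E →L[ℝ] E) (b : E →L[ℝ] E →L[ℝ] ℝ) (y : E) : E →L[ℝ] E →L[ℝ] ℝ :=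
  b.bilinearComp (m y) (m y)

theorem coframeForm_apply (m : E → E →L[ℝ] E) (b : E →L[ℝ] E →L[ℝ] ℝ) (y u v : E) :
    coframeForm m b y u v = b (m y u) (m y v) := rfl

/-- The field of endomorphisms with the constant coefficients `A` in the coframe `m`. -/
def coframeEndo (m l : E → E →L[ℝ] E) (A : E →L[ℝ] E) (y : E) : E →L[ℝ] E :=
  l y ∘L A ∘L m y

theorem coframeEndo_apply (m l : E → E →L[ℝ] E) (A : E →L[ℝ] E) (y u : E) :
    coframeEndo m l A y u = l y (A (m y u)) := rfl

/-- The form `b` on the frame is parallel for the connection `B`. -/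
def IsParallelForm (B : E →L[ℝ] E →L[ℝ] E) (b : E →L[ℝ] E →L[ℝ] ℝ) : Prop :=
  ∀ ξ η ζ, b (B ξ η) ζ + b η (B ξ ζ) = 0

theorem fderiv_apply_apply {F G : Type*} [NormedAddCommGroup F] [NormedSpace ℝ F]
    [NormedAddCommGroup G] [NormedSpace ℝ G] {h : E → F →L[ℝ] G} {y : E}
    (hh : DifferentiableAt ℝ h y) (u : E) (v : F) :
    fderiv ℝ (fun z => h z v) y u = fderiv ℝ h y u v := by
  have := (hh.hasFDerivAt.clm_apply (hasFDerivAt_const v y)).fderiv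
  rw [this]
  simp

namespace IsTorsionFreeCoframe

variable {m l : E → E →L[ℝ] E} {B : E →L[ℝ] E →L[ℝ] E}

section
variable (hm : IsTorsionFreeCoframe m l B)
include hm

theorem differentiable : Differentiable ℝ m := hm.smooth.differentiable (by simp)

theorem coframe_christoffel (y u v : E) :
    m y (frameChristoffel m l B y u v) = fderiv ℝ m y u v + B (m y u) (m y v) :=
  hm.coframe_frame _ _

theorem christoffel_symm (y u v : E) :
    frameChristoffel m l B y u v = frameChristoffel m l B y v u := by
  rw [frameChristoffel, hm.torsion_free, frameChristoffel]

theorem contDiff_christoffel (u v : E) :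
    ContDiff ℝ ∞ fun y => frameChristoffel m l B y u v := by
  have h1 : ContDiff ℝ ∞ (fderiv ℝ m) := hm.smooth.fderiv_right (by simp)
  have h2 : ∀ w, ContDiff ℝ ∞ fun y => m y w := fun w => hm.smooth.clm_apply contDiff_const
  exact hm.smooth_frame.clm_apply (((h1.clm_apply contDiff_const).clm_apply contDiff_const).add
    ((B.contDiff.comp (h2 u)).clm_apply (h2 v)))

theorem coframe_injective (y : E) : Function.Injective (m y) :=
  Function.LeftInverse.injective (hm.frame_coframe y)

theorem hasFDerivAt_coframe_apply (y v : E) :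
    HasFDerivAt (fun z => m z v) ((fderiv ℝ m y).flip v) y := by
  have := (hm.differentiable y).hasFDerivAt.clm_apply (hasFDerivAt_const v y)
  simpa using this

/-- Forms with `B`-parallel coefficients are parallel for the connection on `E`. -/
theorem fderiv_coframeForm_apply {b : E →L[ℝ] E →L[ℝ] ℝ} (hb : IsParallelForm B b)
    (hd : Differentiable ℝ (coframeForm m b)) (y u v w : E) :
    fderiv ℝ (coframeForm m b) y u v w
      = coframeForm m b y (frameChristoffel m l B y u v) w
        + coframeForm m b y v (frameChristoffel m l B y u w) := by
  have h1 : DifferentiableAt ℝ (fun z => coframeForm m b z v) y :=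
    (hd y).clm_apply (differentiableAt_const v)
  rw [← fderiv_apply_apply (hd y), ← fderiv_apply_apply h1]
  have h2 : HasFDerivAt (fun z => coframeForm m b z v w) _ y :=
    (b.hasFDerivAt.comp y (hm.hasFDerivAt_coframe_apply y v)).clm_apply
      (hm.hasFDerivAt_coframe_apply y w)
  rw [h2.fderiv]
  have h3 := hb (m y u) (m y v) (m y w)
  simp only [coframeForm_apply, hm.coframe_christoffel, map_add, add_apply,
    ContinuousLinearMap.comp_apply, ContinuousLinearMap.flip_apply, Function.comp_apply,
    ContinuousLinearMap.coe_coe]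
  linarith

end

theorem contDiff_coframeForm [FiniteDimensional ℝ E] (hm : IsTorsionFreeCoframe m l B)
    (b : E →L[ℝ] E →L[ℝ] ℝ) :
    ContDiff ℝ ∞ (coframeForm m b) := by
  have h2 : ∀ w, ContDiff ℝ ∞ fun y => m y w := fun w => hm.smooth.clm_apply contDiff_const
  rw [contDiff_clm_apply_iff]
  intro v
  rw [contDiff_clm_apply_iff]
  intro w
  exact (b.contDiff.comp (h2 v)).clm_apply (h2 w)

theorem contDiff_coframeEndo (hm : IsTorsionFreeCoframe m l B) (A : E →L[ℝ] E) :
    ContDiff ℝ ∞ (coframeEndo m l A) :=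
  hm.smooth_frame.clm_comp (contDiff_const.clm_comp hm.smooth)

/-- The connection `B` is the Levi-Civita connection of a symmetric, non-degenerate, parallel
form. -/
theorem coordChristoffel_eq [FiniteDimensional ℝ E] (hm : IsTorsionFreeCoframe m l B)
    {b : E →L[ℝ] E →L[ℝ] ℝ} (hb : IsParallelForm B b) (hs : ∀ ξ η, b ξ η = b η ξ)
    (hn : ∀ ξ, (∀ η, b ξ η = 0) → ξ = 0) (y u v : E) :
    coordChristoffel (coframeForm m b) y u v = frameChristoffel m l B y u v := by
  have hd := (hm.contDiff_coframeForm b).differentiable (by simp)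
  set h := coframeForm m b
  have hs' : ∀ u v, h y u v = h y v u := fun u v => hs _ _
  have hinj : Function.Injective (h y) := by
    rw [injective_iff_map_eq_zero]
    intro u hu
    apply hm.coframe_injective y
    rw [map_zero]
    apply hn
    intro η
    have := DFunLike.congr_fun hu (l y η)
    simpa [h, coframeForm_apply, hm.coframe_frame] using this
  have hfin : Module.finrank ℝ E = Module.finrank ℝ (E →L[ℝ] ℝ) := by
    rw [← (LinearMap.toContinuousLinearMap (𝕜 := ℝ) (E := E) (F' := ℝ)).finrank_eq]
    exact (Subspace.dual_finrank_eq).symm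
  have hfin' : FiniteDimensional ℝ (E →L[ℝ] ℝ) :=
    (LinearMap.toContinuousLinearMap (𝕜 := ℝ) (E := E) (F' := ℝ)).finiteDimensional
  let e : E ≃L[ℝ] (E →L[ℝ] ℝ) :=
    (LinearEquiv.ofInjectiveOfFinrankEq (h y).toLinearMap hinj hfin).toContinuousLinearEquiv
  have he : (e : E →L[ℝ] (E →L[ℝ] ℝ)) = h y := by
    ext u v
    rfl
  rw [coordChristoffel, ← he, ContinuousLinearMap.inverse_equiv]
  have : coordKoszul h y u v = e (frameChristoffel m l B y u v) := by
    ext w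
    have e1 := hm.fderiv_coframeForm_apply hb hd y u v w
    have e2 := hm.fderiv_coframeForm_apply hb hd y v u w
    have e3 := hm.fderiv_coframeForm_apply hb hd y w u v
    rw [coordKoszul_apply, e1, e2, e3]
    rw [hm.christoffel_symm y v u, hm.christoffel_symm y w u, hm.christoffel_symm y w v,
      hs' _ v]
    change _ = h y (frameChristoffel m l B y u v) w
    ring
  rw [this]
  simp

/-- Skew-symmetric parallel forms are closed, because the connection is torsion-free. -/
theorem exists_extDeriv_coframeForm_eq_zero [FiniteDimensional ℝ E]
    (hm : IsTorsionFreeCoframe m l B)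
    {b : E →L[ℝ] E →L[ℝ] ℝ} (hb : IsParallelForm B b) (hs : ∀ ξ η, b ξ η = -b η ξ) :
    ∃ Ω : E → E [⋀^Fin 2]→L[ℝ] ℝ, (∀ y u v, Ω y ![u, v] = coframeForm m b y u v) ∧
      ∀ y, extDeriv Ω y = 0 := by
  have hd := (hm.contDiff_coframeForm b).differentiable (by simp)
  let one : (E →L[ℝ] ℝ) →L[ℝ] E [⋀^Fin 1]→L[ℝ] ℝ :=
    ((ContinuousAlternatingMap.ofSubsingletonLIE (𝕜 := ℝ) (E := E) (F := ℝ)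
      (0 : Fin 1)).toContinuousLinearEquiv :
      (E →L[ℝ] ℝ) →L[ℝ] E [⋀^Fin 1]→L[ℝ] ℝ)
  let alt : (E →L[ℝ] E →L[ℝ] ℝ) →L[ℝ] E [⋀^Fin 2]→L[ℝ] ℝ :=
    (1 / 2 : ℝ) • (ContinuousAlternatingMap.alternatizeUncurryFinCLM ℝ E ℝ (n := 1)) ∘L
      ContinuousLinearMap.compL ℝ E _ _ one
  have halt : ∀ y u v, alt (coframeForm m b y) ![u, v] = coframeForm m b y u v := by
    intro y u v
    have : coframeForm m b y v u = -coframeForm m b y u v := hs _ _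
    simp [alt, one, ContinuousAlternatingMap.alternatizeUncurryFin_apply, Fin.sum_univ_two,
      Fin.removeNth, this]
    ring
  have hΩ : Differentiable ℝ fun y => alt (coframeForm m b y) := alt.differentiable.comp hd
  refine ⟨fun y => alt (coframeForm m b y), halt, fun y => ?_⟩
  ext v
  have hv : ∀ i : Fin 3, fderiv ℝ (fun z => alt (coframeForm m b z) (i.removeNth v)) y (v i)
      = fderiv ℝ (coframeForm m b) y (v i) (i.removeNth v 0) (i.removeNth v 1) := by
    intro i
    have e : i.removeNth v = ![i.removeNth v 0, i.removeNth v 1] := by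
      ext j
      fin_cases j <;> rfl
    have h1 : DifferentiableAt ℝ (fun z => coframeForm m b z (i.removeNth v 0)) y :=
      (hd y).clm_apply (differentiableAt_const _)
    rw [← fderiv_apply_apply (hd y), ← fderiv_apply_apply h1]
    congr 2
    funext z
    rw [← halt, ← e]
  rw [extDeriv_apply (hΩ y), Fin.sum_univ_three, hv, hv, hv]
  have r0 : (0 : Fin 3).removeNth v 0 = v 1 ∧ (0 : Fin 3).removeNth v 1 = v 2 := ⟨rfl, rfl⟩
  have r1 : (1 : Fin 3).removeNth v 0 = v 0 ∧ (1 : Fin 3).removeNth v 1 = v 2 := ⟨rfl, rfl⟩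
  have r2 : (2 : Fin 3).removeNth v 0 = v 0 ∧ (2 : Fin 3).removeNth v 1 = v 1 := ⟨rfl, rfl⟩
  rw [r0.1, r0.2, r1.1, r1.2, r2.1, r2.2, hm.fderiv_coframeForm_apply hb hd,
    hm.fderiv_coframeForm_apply hb hd, hm.fderiv_coframeForm_apply hb hd]
  have hs' : ∀ u v, coframeForm m b y u v = -coframeForm m b y v u := fun u v => hs _ _
  rw [hm.christoffel_symm y (v 1) (v 0), hm.christoffel_symm y (v 2) (v 0),
    hm.christoffel_symm y (v 2) (v 1), hs' (v 1) (frameChristoffel m l B y (v 0) (v 2)),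
    hs' (v 0) (frameChristoffel m l B y (v 1) (v 2))]
  simp
  ring

/-- Endomorphisms with `B`-parallel coefficients are parallel for the connection on `E`. -/
theorem fderiv_coframeEndo_apply (hm : IsTorsionFreeCoframe m l B) {A : E →L[ℝ] E}
    (hA : ∀ ξ η, B ξ (A η) = A (B ξ η)) {X : E → E} {y : E} (hX : DifferentiableAt ℝ X y) (u : E) :
    fderiv ℝ (fun z => coframeEndo m l A z (X z)) y u
      = coframeEndo m l A y (fderiv ℝ X y u + frameChristoffel m l B y u (X y))
        - frameChristoffel m l B y u (coframeEndo m l A y (X y)) := by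
  have hJ : DifferentiableAt ℝ (fun z => coframeEndo m l A z (X z)) y :=
    ((hm.contDiff_coframeEndo A).differentiable (by simp) y).clm_apply hX
  have h1 := ((hm.differentiable y).hasFDerivAt.clm_apply hJ.hasFDerivAt).fderiv
  have h2 := (A.hasFDerivAt.comp y
    ((hm.differentiable y).hasFDerivAt.clm_apply hX.hasFDerivAt)).fderiv
  have h3 : (fun z => m z (coframeEndo m l A z (X z))) = A ∘ fun z => m z (X z) := by
    funext z
    simp [coframeEndo_apply, hm.coframe_frame]
  rw [h3] at h1
  have h4 := DFunLike.congr_fun (h1.symm.trans h2) u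
  simp only [add_apply, ContinuousLinearMap.comp_apply, ContinuousLinearMap.flip_apply,
    map_add] at h4
  apply hm.coframe_injective y
  rw [map_sub, hm.coframe_christoffel]
  simp only [coframeEndo_apply, hm.coframe_frame, map_add, hm.coframe_christoffel, hA] at h4 ⊢
  rw [eq_sub_iff_add_eq, ← sub_eq_zero]
  rw [← sub_eq_zero] at h4
  rw [← h4]
  abel

/-- The Nijenhuis tensor of a parallel almost complex structure vanishes, because the connection
is torsion-free. -/
theorem nijenhuis_coframeEndo (hm : IsTorsionFreeCoframe m l B) {A : E →L[ℝ] E}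
    (hA : ∀ ξ η, B ξ (A η) = A (B ξ η)) (hA2 : ∀ ξ, A (A ξ) = -ξ) {X Y : E → E} {y : E}
    (hX : DifferentiableAt ℝ X y) (hY : DifferentiableAt ℝ Y y) :
    VectorField.lieBracket ℝ (fun z => coframeEndo m l A z (X z))
        (fun z => coframeEndo m l A z (Y z)) y
      - coframeEndo m l A y
          (VectorField.lieBracket ℝ (fun z => coframeEndo m l A z (X z)) Y y)
      - coframeEndo m l A y
          (VectorField.lieBracket ℝ X (fun z => coframeEndo m l A z (Y z)) y)
      - VectorField.lieBracket ℝ X Y y = 0 := by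
  have hJ2 : ∀ v, coframeEndo m l A y (coframeEndo m l A y v) = -v := by
    intro v
    simp [coframeEndo_apply, hm.coframe_frame, hA2, hm.frame_coframe]
  have hJY := hm.christoffel_symm y
  simp only [VectorField.lieBracket, hm.fderiv_coframeEndo_apply hA hX,
    hm.fderiv_coframeEndo_apply hA hY, map_sub, map_add, hJ2]
  rw [hJY (coframeEndo m l A y (Y y)) (coframeEndo m l A y (X y)), hJY (Y y) (X y),
    hJY (coframeEndo m l A y (X y)) (Y y), hJY (coframeEndo m l A y (Y y)) (X y)]
  abel

theorem coframe_fderiv_christoffel (hm : IsTorsionFreeCoframe m l B) (y u v w : E) :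
    m y (fderiv ℝ (fun z => frameChristoffel m l B z v w) y u)
      = fderiv ℝ (fderiv ℝ m) y u v w + B (fderiv ℝ m y u v) (m y w)
        + B (m y v) (fderiv ℝ m y u w) - fderiv ℝ m y u (frameChristoffel m l B y v w) := by
  have hΓ : DifferentiableAt ℝ (fun z => frameChristoffel m l B z v w) y :=
    (hm.contDiff_christoffel v w).differentiable (by simp) y
  have hm1 : ContDiff ℝ ∞ (fderiv ℝ m) := hm.smooth.fderiv_right (by simp)
  have hm2 : DifferentiableAt ℝ (fderiv ℝ m) y := hm1.differentiable (by simp) y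
  have h1 := ((hm.differentiable y).hasFDerivAt.clm_apply hΓ.hasFDerivAt).fderiv
  have h2 := (((hm2.hasFDerivAt.clm_apply (hasFDerivAt_const v y)).clm_apply
    (hasFDerivAt_const w y)).add
      ((B.hasFDerivAt.comp y (hm.hasFDerivAt_coframe_apply y v)).clm_apply
        (hm.hasFDerivAt_coframe_apply y w))).fderiv
  have h3 : (fun z => m z (frameChristoffel m l B z v w))
      = fun z => fderiv ℝ m z v w + B (m z v) (m z w) :=
    funext fun z => hm.coframe_christoffel z v w
  rw [h3] at h1
  have h4 := DFunLike.congr_fun (h1.symm.trans h2) u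
  simp only [add_apply, ContinuousLinearMap.comp_apply, ContinuousLinearMap.flip_apply,
    Function.comp_apply, zero_apply, map_zero, zero_add] at h4
  rw [eq_sub_iff_add_eq, h4]
  abel

/-- In the frame, the curvature has the constant coefficients `frameCurvature B`. -/
theorem coordCurvature_eq (hm : IsTorsionFreeCoframe m l B) {h : E → E →L[ℝ] E →L[ℝ] ℝ} {y : E}
    (hh : ∀ᶠ z in nhds y, ∀ u v, coordChristoffel h z u v = frameChristoffel m l B z u v)
    (u v w : E) :
    coordCurvature h y u v w = l y (frameCurvature B (m y u) (m y v) (m y w)) := by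
  have hd : ∀ v w, fderiv ℝ (fun z => coordChristoffel h z v w) y
      = fderiv ℝ (fun z => frameChristoffel m l B z v w) y := fun v w =>
    Filter.EventuallyEq.fderiv_eq (hh.mono fun z hz => hz v w)
  have h0 := hh.self_of_nhds
  have hsymm : fderiv ℝ (fderiv ℝ m) y u v = fderiv ℝ (fderiv ℝ m) y v u := by
    have : ContDiffAt ℝ 2 m y := (hm.smooth.of_le (by norm_cast)).contDiffAt
    exact (this.isSymmSndFDerivAt (by simp)).eq u v
  apply hm.coframe_injective y
  rw [hm.coframe_frame, coordCurvature, hd, hd]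
  simp only [h0, map_add, map_sub, hm.coframe_fderiv_christoffel, hm.coframe_christoffel]
  have htf := hm.torsion_free y u v
  have : B (B (m y u) (m y v) - B (m y v) (m y u)) (m y w)
      = B (fderiv ℝ m y v u - fderiv ℝ m y u v) (m y w) := by
    congr 2
    rw [sub_eq_sub_iff_add_eq_add, add_comm, htf, add_comm]
  rw [frameCurvature, this, hsymm]
  simp only [map_sub, sub_apply]
  abel

/-- A curve whose velocity has the components `ξ` in the coframe is a geodesic if
`ξ' = -B(ξ, ξ)`. -/
theorem geodesic_of_coframe (hm : IsTorsionFreeCoframe m l B) {c c' ξ : ℝ → E}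
    {t : ℝ} {a : E} (hc : HasDerivAt c (c' t) t) (hc' : HasDerivAt c' a t)
    (hξ : ∀ s, m (c s) (c' s) = ξ s) (hξ' : HasDerivAt ξ (-B (ξ t) (ξ t)) t) :
    a + frameChristoffel m l B (c t) (c' t) (c' t) = 0 := by
  apply hm.coframe_injective (c t)
  have h1 := ((hm.differentiable (c t)).hasFDerivAt.comp_hasDerivAt t hc).clm_apply hc'
  have h2 : (fun s => (m ∘ c) s (c' s)) = ξ := funext hξ
  rw [h2] at h1
  have h3 := h1.unique hξ'
  rw [map_add, hm.coframe_christoffel, hξ, map_zero]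
  simp only [Function.comp_apply] at h3
  rw [← add_assoc, add_comm (m (c t) a), h3]
  simp

end IsTorsionFreeCoframe
end TorsionFreeCoframe

/-! ### The Lie group and its Maurer-Cartan form -/

/-- The derivative of a map which is quadratic along the line `y + ℝ u`, from its linear
coefficient. -/
theorem fderiv_apply_eq_of_quadratic {E F : Type*} [NormedAddCommGroup E] [NormedSpace ℝ E]
    [NormedAddCommGroup F] [NormedSpace ℝ F] {f : E → F} {y u : E} {a b : F}
    (hf : DifferentiableAt ℝ f y) (h : ∀ t : ℝ, f (y + t • u) = f y + t • a + t ^ 2 • b) :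
    fderiv ℝ f y u = a := by
  have h1 : HasDerivAt (fun t : ℝ => f (y + t • u)) (fderiv ℝ f y u) 0 := by
    have h2 : HasDerivAt (fun t : ℝ => y + t • u) u 0 := by
      simpa using ((hasDerivAt_id (0 : ℝ)).smul_const u).const_add y
    have h3 : HasFDerivAt f (fderiv ℝ f y) (y + (0 : ℝ) • u) := by
      simpa using hf.hasFDerivAt
    exact h3.comp_hasDerivAt 0 h2
  have h4 : HasDerivAt (fun t : ℝ => f y + t • a + t ^ 2 • b) a 0 := by
    have := (((hasDerivAt_id (0 : ℝ)).smul_const a).const_add (f y)).add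
      (((hasDerivAt_id (0 : ℝ)).pow 2).smul_const b)
    simp only [id_eq, one_smul, Nat.cast_ofNat, Nat.add_one_sub_one, pow_one, mul_zero, zero_mul,
      zero_smul, add_zero] at this
    exact this
  rw [funext h] at h1
  exact h1.unique h4

namespace AffineSymplecticPair

section Group
variable {V : Type*} [AddCommGroup V] [Module ℝ V] (D : AffineSymplecticPair V)

variable {D} in
theorem N_ext {p q : D.N} (h1 : p.1 = q.1) (h2 : p.2 = q.2) : p = q := Prod.ext h1 h2

/-- The point of `N_{∇,∇'}` with the given components. -/
def mkN (x x' : V) : D.N := (x, x')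

theorem mkN_fst (x x' : V) : (D.mkN x x').1 = x := rfl
theorem mkN_snd (x x' : V) : (D.mkN x x').2 = x' := rfl

/-- The totally symmetric trilinear map `∇_x ∇'_y z`. All products of two of the operators `∇_x` and
`∇'_x` are zero or, up to sign, given by this map, and all products of three of them vanish. -/
def cubic (x y z : V) : V := D.nabla x (D.nabla' y z)

theorem nabla_nabla'_eq (x y z : V) : D.nabla x (D.nabla' y z) = D.cubic x y z := rfl

theorem cubic_swap_left (x y z : V) : D.cubic x y z = D.cubic y x z := D.swap x y z

theorem cubic_swap_right (x y z : V) : D.cubic x y z = D.cubic x z y := D.swap_last x y z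

theorem nabla_nabla'_left_eq (x y z : V) : D.nabla (D.nabla' x y) z = D.cubic z x y :=
  D.affine.torsion_free _ _

theorem nabla'_nabla_eq (x y z : V) : D.nabla' x (D.nabla y z) = -D.cubic x y z :=
  D.nabla'_nabla x y z

theorem nabla'_nabla_left_eq (x y z : V) : D.nabla' (D.nabla x y) z = -D.cubic z x y :=
  D.nabla'_nabla_left x y z

theorem nabla_cubic (x y z w : V) : D.nabla w (D.cubic x y z) = 0 := D.nabla_nabla _ _ _

theorem nabla_cubic_left (x y z w : V) : D.nabla (D.cubic x y z) w = 0 := D.nabla_nabla_left _ _ _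

theorem nabla'_cubic (x y z w : V) : D.nabla' w (D.cubic x y z) = 0 := by
  rw [cubic, ← neg_neg (D.nabla x _), ← nabla'_nabla, map_neg, nabla'_nabla', neg_zero]

theorem nabla'_cubic_left (x y z w : V) : D.nabla' (D.cubic x y z) w = 0 := by
  rw [D.affine'.torsion_free, nabla'_cubic]

theorem cubic_nabla_right (x y z w : V) : D.cubic x y (D.nabla z w) = 0 := by
  rw [cubic, nabla'_nabla, map_neg, nabla_nabla, neg_zero]

theorem cubic_nabla_mid (x y z w : V) : D.cubic x (D.nabla z w) y = 0 := by
  rw [cubic_swap_right, cubic_nabla_right]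

theorem cubic_nabla_left (x y z w : V) : D.cubic (D.nabla z w) x y = 0 := by
  rw [cubic_swap_left, cubic_nabla_mid]

theorem cubic_nabla'_right (x y z w : V) : D.cubic x y (D.nabla' z w) = 0 := by
  rw [cubic, nabla'_nabla', map_zero]

theorem cubic_nabla'_mid (x y z w : V) : D.cubic x (D.nabla' z w) y = 0 := by
  rw [cubic_swap_right, cubic_nabla'_right]

theorem cubic_nabla'_left (x y z w : V) : D.cubic (D.nabla' z w) x y = 0 := by
  rw [cubic_swap_left, cubic_nabla'_mid]

theorem cubic_cubic_left (x y u v w : V) : D.cubic (D.cubic u v w) x y = 0 :=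
  D.cubic_nabla_left ..

theorem omega_connection (x x' y z : V) :
    D.omega (D.nabla x y + D.nabla' x' y) z = -D.omega y (D.nabla x z + D.nabla' x' z) := by
  rw [map_add, LinearMap.add_apply, D.compat, D.compat', ← D.symplectic.skew, map_add,
    LinearMap.add_apply]

end Group

section Components
variable {V : Type*} [NormedAddCommGroup V] [NormedSpace ℝ V] (D : AffineSymplecticPair V)

theorem add_fst (p q : D.N) : (p + q).1 = p.1 + q.1 := rfl
theorem add_snd (p q : D.N) : (p + q).2 = p.2 + q.2 := rfl
theorem sub_fst (p q : D.N) : (p - q).1 = p.1 - q.1 := rfl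
theorem sub_snd (p q : D.N) : (p - q).2 = p.2 - q.2 := rfl
theorem neg_fst (p : D.N) : (-p).1 = -p.1 := rfl
theorem neg_snd (p : D.N) : (-p).2 = -p.2 := rfl
theorem smul_fst (t : ℝ) (p : D.N) : (t • p).1 = t • p.1 := rfl
theorem smul_snd (t : ℝ) (p : D.N) : (t • p).2 = t • p.2 := rfl
theorem zero_fst : (0 : D.N).1 = 0 := rfl
theorem zero_snd : (0 : D.N).2 = 0 := rfl
theorem one_eq_zero : (1 : D.N) = 0 := rfl

/-- The complex structure of the Lie algebra. -/
def JN : D.N →L[ℝ] D.N := JOne (V := V)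

/-- The product structure of the Lie algebra. -/
def EN : D.N →L[ℝ] D.N := EOne (V := V)

theorem JN_apply (u : D.N) : D.JN u = D.mkN (-u.2) u.1 := rfl

theorem EN_apply (u : D.N) : D.EN u = D.mkN u.1 (-u.2) := rfl

theorem JN_JN (u : D.N) : D.JN (D.JN u) = -u := rfl

theorem EN_EN (u : D.N) : D.EN (D.EN u) = u := by
  apply N_ext
  · rfl
  · exact neg_neg u.2

theorem JN_EN (u : D.N) : D.JN (D.EN u) = -D.EN (D.JN u) := by
  apply N_ext <;> simp only [JN_apply, EN_apply, mkN_fst, mkN_snd, neg_fst, neg_snd, neg_neg]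

end Components

variable {V : Type*} [NormedAddCommGroup V] [NormedSpace ℝ V] [FiniteDimensional ℝ V]
variable (D : AffineSymplecticPair V)

theorem differentiable_mul_left (p : D.N) : Differentiable ℝ fun q : D.N => p * q := by
  have h : ContDiff ℝ ω fun q : D.N => p * q :=
    D.contDiff_mul.comp (contDiff_const.prodMk contDiff_id)
  exact h.differentiable (by simp)

theorem contDiff_mul_left (p : D.N) : ContDiff ℝ ∞ fun q : D.N => p * q := by
  have h : ContDiff ℝ ω fun q : D.N => p * q :=
    D.contDiff_mul.comp (contDiff_const.prodMk contDiff_id)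
  exact h.of_le le_top

theorem leftDeriv_apply (p u : D.N) :
    D.leftDeriv p u = D.mkN (u.1 + D.nabla' u.1 p.2)
      (u.2 - D.nabla p.2 u.1 - (1 / 2 : ℝ) • D.nabla p.2 (D.nabla' p.2 u.1)) := by
  refine fderiv_apply_eq_of_quadratic (D.differentiable_mul_left p 1)
    (b := D.mkN (-(1 / 2 : ℝ) • D.nabla' u.1 (D.nabla u.1 p.2)) 0) fun t => ?_
  rw [one_eq_zero, zero_add]
  apply N_ext <;>
  · simp only [mul_fst, mul_snd, alpha, beta, mkN_fst, mkN_snd, add_fst, add_snd, smul_fst,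
      smul_snd, zero_fst, zero_snd, map_smul, map_zero, LinearMap.smul_apply, LinearMap.zero_apply]
    module

theorem maurerCartan_leftDeriv (p u : D.N) : D.maurerCartan p (D.leftDeriv p u) = u := by
  have h1 : HasFDerivAt (fun q : D.N => p * q) (D.leftDeriv p) 1 :=
    (D.differentiable_mul_left p 1).hasFDerivAt
  have h2 : HasFDerivAt (fun q : D.N => p⁻¹ * q) (D.maurerCartan p) (p * 1) := by
    rw [mul_one]
    exact (D.differentiable_mul_left p⁻¹ p).hasFDerivAt
  have h3 := h2.comp 1 h1
  have h4 : (fun q : D.N => p⁻¹ * q) ∘ (fun q : D.N => p * q) = id := by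
    funext q
    simp
  rw [h4] at h3
  exact DFunLike.congr_fun (h3.unique (hasFDerivAt_id 1)) u

theorem maurerCartan_apply (p v : D.N) :
    D.maurerCartan p v = D.mkN (v.1 - D.nabla' v.1 p.2)
      (v.2 + D.nabla p.2 v.1 - (1 / 2 : ℝ) • D.nabla p.2 (D.nabla' p.2 v.1)) := by
  have h : v = D.leftDeriv p (D.mkN (v.1 - D.nabla' v.1 p.2)
      (v.2 + D.nabla p.2 v.1 - (1 / 2 : ℝ) • D.nabla p.2 (D.nabla' p.2 v.1))) := by
    rw [leftDeriv_apply]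
    apply N_ext <;>
    · simp only [mkN_fst, mkN_snd, map_sub, LinearMap.sub_apply, nabla'_nabla'_left, nabla'_nabla',
        map_zero, D.swap_last p.2 v.1 p.2]
      module
  conv_lhs => rw [h]
  rw [maurerCartan_leftDeriv]

theorem leftDeriv_maurerCartan (p v : D.N) : D.leftDeriv p (D.maurerCartan p v) = v := by
  rw [maurerCartan_apply, leftDeriv_apply]
  apply N_ext <;>
  · simp only [mkN_fst, mkN_snd, map_sub, LinearMap.sub_apply, nabla'_nabla'_left, nabla'_nabla',
      map_zero, D.swap_last p.2 v.1 p.2]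
    module

/-- The Maurer-Cartan form is left-invariant. -/
theorem maurerCartan_fderiv_mul_left (p q u : D.N) :
    D.maurerCartan (p * q) (fderiv ℝ (fun r : D.N => p * r) q u) = D.maurerCartan q u := by
  have h1 : HasFDerivAt (fun r : D.N => q * r) (D.leftDeriv q) 1 :=
    (D.differentiable_mul_left q 1).hasFDerivAt
  have h2 : HasFDerivAt (fun r : D.N => p * r) (fderiv ℝ (fun r : D.N => p * r) q) (q * 1) := by
    rw [mul_one]
    exact (D.differentiable_mul_left p q).hasFDerivAt
  have h3 := h2.comp 1 h1
  have h4 : (fun r : D.N => p * r) ∘ (fun r : D.N => q * r) = fun r => p * q * r := by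
    funext r
    simp [mul_assoc]
  rw [h4] at h3
  have h5 := DFunLike.congr_fun
    (h3.unique (D.differentiable_mul_left (p * q) 1).hasFDerivAt) (D.maurerCartan q u)
  rw [ContinuousLinearMap.comp_apply, leftDeriv_maurerCartan] at h5
  rw [h5]
  exact D.maurerCartan_leftDeriv _ _

theorem fderiv_mul_left (p q u : D.N) :
    fderiv ℝ (fun r : D.N => p * r) q u = D.leftDeriv (p * q) (D.maurerCartan q u) := by
  rw [← D.maurerCartan_fderiv_mul_left p q u, leftDeriv_maurerCartan]

theorem contDiff_maurerCartan : ContDiff ℝ ∞ D.maurerCartan := by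
  rw [contDiff_clm_apply_iff]
  intro v
  simp only [maurerCartan_apply]
  have h2 : ContDiff ℝ ω fun p : V × V => p.2 := contDiff_snd
  have h : ContDiff ℝ ω fun p : V × V => (v.1 - D.nabla' v.1 p.2,
      v.2 + D.nabla p.2 v.1 - (1 / 2 : ℝ) • D.nabla p.2 (D.nabla' p.2 v.1)) :=
    ContDiff.prodMk (contDiff_const.sub (contDiff_bilin _ contDiff_const h2))
      ((contDiff_const.add (contDiff_bilin _ h2 contDiff_const)).sub
        ((contDiff_bilin _ h2 (contDiff_bilin _ h2 contDiff_const)).const_smul _))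
  exact ContDiff.of_le h le_top

theorem contDiff_leftDeriv : ContDiff ℝ ∞ D.leftDeriv := by
  rw [contDiff_clm_apply_iff]
  intro v
  simp only [leftDeriv_apply]
  have h2 : ContDiff ℝ ω fun p : V × V => p.2 := contDiff_snd
  have h : ContDiff ℝ ω fun p : V × V => (v.1 + D.nabla' v.1 p.2,
      v.2 - D.nabla p.2 v.1 - (1 / 2 : ℝ) • D.nabla p.2 (D.nabla' p.2 v.1)) :=
    ContDiff.prodMk (contDiff_const.add (contDiff_bilin _ contDiff_const h2))
      ((contDiff_const.sub (contDiff_bilin _ h2 contDiff_const)).sub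
        ((contDiff_bilin _ h2 (contDiff_bilin _ h2 contDiff_const)).const_smul _))
  exact ContDiff.of_le h le_top

theorem fderiv_maurerCartan_apply (p u v : D.N) :
    fderiv ℝ D.maurerCartan p u v
      = D.mkN (-D.nabla' v.1 u.2) (D.nabla u.2 v.1 - D.nabla u.2 (D.nabla' p.2 v.1)) := by
  have hd : Differentiable ℝ D.maurerCartan := D.contDiff_maurerCartan.differentiable (by simp)
  rw [← fderiv_apply_apply (hd p)]
  refine fderiv_apply_eq_of_quadratic ((hd p).clm_apply (differentiableAt_const v))
    (b := D.mkN 0 (-(1 / 2 : ℝ) • D.nabla u.2 (D.nabla' u.2 v.1))) fun t => ?_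
  simp only [maurerCartan_apply]
  apply N_ext <;>
  · simp only [mkN_fst, mkN_snd, add_fst, add_snd, smul_fst, smul_snd, map_add, map_smul,
      LinearMap.smul_apply, LinearMap.add_apply, D.swap p.2 u.2]
    module

/-- The Levi-Civita connection of the left-invariant metric on the Lie algebra `V × V`:
`(x, x'), (y, y') ↦ (∇_x y + ∇'_{x'} y, ∇_x y' + ∇'_{x'} y')`. -/
def connection : D.N →L[ℝ] D.N →L[ℝ] D.N :=
  LinearMap.toContinuousLinearMap ((LinearMap.toContinuousLinearMap (E := D.N)
    (F' := D.N)).toLinearMap ∘ₗ LinearMap.mk₂ ℝ (fun u v : D.N =>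
      D.mkN (D.nabla u.1 v.1 + D.nabla' u.2 v.1) (D.nabla u.1 v.2 + D.nabla' u.2 v.2))
    (by
      intro u u' v
      apply N_ext <;> simp only [mkN_fst, mkN_snd, add_fst, add_snd, map_add,
        LinearMap.add_apply] <;> abel)
    (by
      intro t u v
      apply N_ext <;> simp only [mkN_fst, mkN_snd, smul_fst, smul_snd, map_smul,
        LinearMap.smul_apply, smul_add])
    (by
      intro u v v'
      apply N_ext <;> simp only [mkN_fst, mkN_snd, add_fst, add_snd, map_add] <;> abel)
    (by
      intro t u v
      apply N_ext <;> simp only [mkN_fst, mkN_snd, smul_fst, smul_snd, map_smul, smul_add]))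

theorem connection_apply (u v : D.N) :
    D.connection u v
      = D.mkN (D.nabla u.1 v.1 + D.nabla' u.2 v.1) (D.nabla u.1 v.2 + D.nabla' u.2 v.2) := rfl

theorem isTorsionFreeCoframe : IsTorsionFreeCoframe D.maurerCartan D.leftDeriv D.connection where
  smooth := D.contDiff_maurerCartan
  smooth_frame := D.contDiff_leftDeriv
  frame_coframe := D.leftDeriv_maurerCartan
  coframe_frame := D.maurerCartan_leftDeriv
  torsion_free y u v := by
    simp only [fderiv_maurerCartan_apply, connection_apply, maurerCartan_apply]
    apply N_ext <;>
    · simp only [mkN_fst, mkN_snd, add_fst, add_snd, map_add, map_sub, map_smul,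
        LinearMap.add_apply, LinearMap.sub_apply, LinearMap.smul_apply, nabla_nabla, nabla'_nabla',
        nabla_nabla'_eq, nabla_nabla'_left_eq, nabla'_nabla_eq, nabla'_nabla_left_eq, nabla_cubic,
        nabla'_cubic, nabla'_cubic_left, cubic_nabla_left, cubic_nabla'_left, cubic_cubic_left,
        neg_zero]
      simp only [D.affine.torsion_free, D.affine'.torsion_free, D.cubic_swap_left,
        D.cubic_swap_right]
      module

end AffineSymplecticPair

/-! ### The left-invariant metric: curvature and geodesics -/

namespace AffineSymplecticPair
section Geodesics
variable {V : Type*} [NormedAddCommGroup V] [NormedSpace ℝ V] (D : AffineSymplecticPair V)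

/-- The geodesic with initial point `1` and initial velocity `v`. As the components of its velocity
in the left-invariant frame are affine in `t`, it is a polynomial. -/
def geodesicOne (v : D.N) (t : ℝ) : D.N :=
  t • v + t ^ 2 • D.mkN (-(1 / 2 : ℝ) • D.nabla v.1 v.1)
      (-(1 / 2 : ℝ) • ((2 : ℝ) • D.nabla v.1 v.2 + D.nabla' v.2 v.2))
    + t ^ 3 • D.mkN ((2 / 3 : ℝ) • D.nabla v.1 (D.nabla' v.1 v.2))
      ((1 / 3 : ℝ) • D.nabla v.1 (D.nabla' v.2 v.2))

theorem contDiff_geodesicOne (v : D.N) : ContDiff ℝ ∞ (D.geodesicOne v) := by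
  unfold geodesicOne
  fun_prop

theorem geodesicOne_zero (v : D.N) : D.geodesicOne v 0 = 1 := by
  simp [geodesicOne, one_eq_zero]

end Geodesics

variable {V : Type*} [NormedAddCommGroup V] [NormedSpace ℝ V] [FiniteDimensional ℝ V]
variable (D : AffineSymplecticPair V)

/-- The inner product of the Lie algebra. -/
def metricN : D.N →L[ℝ] D.N →L[ℝ] ℝ := D.metricOne

theorem metricN_apply (u v : D.N) : D.metricN u v = -D.omega u.1 v.2 + D.omega u.2 v.1 := rfl

theorem metricN_symm (u v : D.N) : D.metricN u v = D.metricN v u := by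
  rw [metricN_apply, metricN_apply, D.symplectic.skew u.1, D.symplectic.skew u.2]
  ring

theorem metricN_nondegenerate (u : D.N) (h : ∀ v, D.metricN u v = 0) : u = 0 := by
  apply N_ext
  · apply D.eq_zero_of_omega
    intro w
    have := h (D.mkN 0 w)
    simpa [metricN_apply, mkN_fst, mkN_snd] using this
  · apply D.eq_zero_of_omega
    intro w
    have := h (D.mkN w 0)
    simpa [metricN_apply, mkN_fst, mkN_snd] using this

theorem metricN_JN (u v : D.N) : D.metricN (D.JN u) (D.JN v) = D.metricN u v := by
  simp only [metricN_apply, JN_apply, mkN_fst, mkN_snd, map_neg, LinearMap.neg_apply]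
  ring

theorem metricN_EN (u v : D.N) : D.metricN (D.EN u) (D.EN v) = -D.metricN u v := by
  simp only [metricN_apply, EN_apply, mkN_fst, mkN_snd, map_neg, LinearMap.neg_apply]
  ring

theorem connection_JN (u v : D.N) : D.connection u (D.JN v) = D.JN (D.connection u v) := by
  apply N_ext <;>
  · simp only [connection_apply, JN_apply, mkN_fst, mkN_snd, map_neg]
    try abel

theorem connection_EN (u v : D.N) : D.connection u (D.EN v) = D.EN (D.connection u v) := by
  apply N_ext <;>
  · simp only [connection_apply, EN_apply, mkN_fst, mkN_snd, map_neg]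
    try abel

theorem isParallelForm_metricN : IsParallelForm D.connection D.metricN := by
  intro ξ η ζ
  simp only [metricN_apply, connection_apply, mkN_fst, mkN_snd, omega_connection]
  ring

variable {D} in
/-- If `b` and `A` are parallel, then so is `b (A ·, ·)`. -/
theorem isParallelForm_comp {E : Type*} [NormedAddCommGroup E] [NormedSpace ℝ E]
    {B : E →L[ℝ] E →L[ℝ] E} {b : E →L[ℝ] E →L[ℝ] ℝ} (hb : IsParallelForm B b) {A : E →L[ℝ] E}
    (hA : ∀ ξ η, B ξ (A η) = A (B ξ η)) : IsParallelForm B (b ∘L A) := by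
  intro ξ η ζ
  have := hb ξ (A η) ζ
  rw [hA] at this
  exact this

/-- The curvature of the left-invariant metric at the identity. It is governed by the symmetric
trilinear map `D.cubic`. -/
theorem frameCurvature_connection (ξ η ζ : D.N) :
    frameCurvature D.connection ξ η ζ
      = (4 : ℝ) • D.mkN (D.cubic ξ.1 η.2 ζ.1 - D.cubic η.1 ξ.2 ζ.1)
          (D.cubic ξ.1 η.2 ζ.2 - D.cubic η.1 ξ.2 ζ.2) := by
  rw [frameCurvature]
  simp only [connection_apply]
  apply N_ext <;>
  · simp only [mkN_fst, mkN_snd, sub_fst, sub_snd, smul_fst, smul_snd, map_add, map_sub,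
      LinearMap.add_apply, LinearMap.sub_apply, nabla_nabla, nabla'_nabla', nabla_nabla'_eq,
      nabla_nabla'_left_eq, nabla'_nabla_eq, nabla'_nabla_left_eq, nabla_nabla_left,
      nabla'_nabla'_left]
    simp only [D.cubic_swap_left, D.cubic_swap_right]
    module

/-- The Ricci tensor of a metric whose Christoffel symbols are those of the frame connection. It
vanishes because `ξ ↦ R(ξ, η) ζ` has square zero. -/
theorem coordRicci_eq_zero {h : D.N → D.N →L[ℝ] D.N →L[ℝ] ℝ} {y : D.N}
    (hh : ∀ᶠ z in nhds y, ∀ u v, coordChristoffel h z u v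
      = frameChristoffel D.maurerCartan D.leftDeriv D.connection z u v) (v w : D.N) :
    coordRicci h y v w = 0 := by
  set η := D.maurerCartan y v
  set ζ := D.maurerCartan y w
  let R : D.N →ₗ[ℝ] D.N :=
    { toFun := fun ξ => frameCurvature D.connection ξ η ζ
      map_add' := by
        intro ξ ξ'
        simp only [frameCurvature, map_add, map_sub, add_apply, sub_apply]
        abel
      map_smul' := by
        intro t ξ
        simp only [frameCurvature, map_smul, map_sub, smul_apply, sub_apply, RingHom.id_apply,
          smul_sub] }
  let T : D.N →ₗ[ℝ] D.N :=
    (D.leftDeriv y).toLinearMap ∘ₗ R ∘ₗ (D.maurerCartan y).toLinearMap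
  have hT : ∀ u, T u = coordCurvature h y u v w := fun u =>
    (D.isTorsionFreeCoframe.coordCurvature_eq hh u v w).symm
  have hR : ∀ ξ, R (R ξ) = 0 := by
    intro ξ
    change frameCurvature D.connection (frameCurvature D.connection ξ η ζ) η ζ = 0
    simp only [frameCurvature_connection, cubic]
    apply N_ext <;>
    · simp only [mkN_fst, mkN_snd, smul_fst, smul_snd, map_sub, map_smul, LinearMap.sub_apply,
        LinearMap.smul_apply, nabla_nabla'_eq, nabla'_cubic_left, cubic_cubic_left, map_zero,
        sub_self, smul_zero]
      rfl
  have hT2 : IsNilpotent T := by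
    refine ⟨2, ?_⟩
    apply LinearMap.ext
    intro u
    rw [pow_two]
    change D.leftDeriv y (R (D.maurerCartan y (D.leftDeriv y (R (D.maurerCartan y u))))) = 0
    rw [maurerCartan_leftDeriv, hR, map_zero]
  have htr := (LinearMap.isNilpotent_trace_of_isNilpotent hT2).eq_zero
  rw [LinearMap.trace_eq_matrix_trace ℝ (Module.finBasis ℝ D.N), Matrix.trace] at htr
  rw [coordRicci, ← htr]
  refine Finset.sum_congr rfl fun i _ => ?_
  rw [Matrix.diag_apply, LinearMap.toMatrix_apply, hT]
  rfl

theorem hasDerivAt_geodesicOne (v : D.N) (t : ℝ) :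
    HasDerivAt (D.geodesicOne v)
      (D.leftDeriv (D.geodesicOne v t) (v - t • D.connection v v)) t := by
  have h : ∀ w z : D.N, HasDerivAt (fun t : ℝ => t • v + t ^ 2 • w + t ^ 3 • z)
      (v + (2 * t) • w + (3 * t ^ 2) • z) t := by
    intro w z
    have h1 := (hasDerivAt_id t).smul_const v
    have h2 := ((hasDerivAt_id t).pow 2).smul_const w
    have h3 := ((hasDerivAt_id t).pow 3).smul_const z
    have := (h1.add h2).add h3
    simp only [id_eq, one_smul, Nat.cast_ofNat, Nat.add_one_sub_one, pow_one, mul_one] at this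
    exact this
  convert! h _ _ using 1
  rw [leftDeriv_apply, connection_apply, geodesicOne]
  apply N_ext <;>
  · simp only [mkN_fst, mkN_snd, add_fst, add_snd, sub_fst, sub_snd, smul_fst, smul_snd, map_add,
      map_sub, map_smul, smul_add, smul_sub, LinearMap.add_apply, LinearMap.sub_apply,
      LinearMap.smul_apply, nabla_nabla, nabla'_nabla', nabla_nabla'_eq, nabla_nabla'_left_eq,
      nabla'_nabla_eq, nabla'_nabla_left_eq, nabla_nabla_left, nabla'_nabla'_left, nabla_cubic,
      nabla_cubic_left, nabla'_cubic, nabla'_cubic_left, cubic_nabla_left, cubic_nabla'_left,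
      cubic_cubic_left, map_zero, neg_zero, map_neg, smul_zero]
    simp only [D.affine.torsion_free, D.affine'.torsion_free, D.cubic_swap_left, D.cubic_swap_right]
    module

/-- The components of the velocity of a geodesic in the left-invariant frame change linearly,
because `D.connection v v` annihilates everything. -/
theorem connection_velocity (v : D.N) (t : ℝ) :
    D.connection (v - t • D.connection v v) (v - t • D.connection v v) = D.connection v v := by
  simp only [connection_apply]
  apply N_ext <;>
  · simp only [mkN_fst, mkN_snd, sub_fst, sub_snd, smul_fst, smul_snd, map_add, map_sub, map_smul,
      smul_add, smul_sub, LinearMap.add_apply, LinearMap.sub_apply, LinearMap.smul_apply,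
      nabla_nabla, nabla'_nabla', nabla_nabla'_eq, nabla_nabla'_left_eq, nabla'_nabla_eq,
      nabla'_nabla_left_eq, nabla_nabla_left, nabla'_nabla'_left, cubic_nabla_left,
      cubic_nabla'_left, neg_zero, smul_zero]
    simp only [D.affine'.torsion_free, D.cubic_swap_left, D.cubic_swap_right]
    module

theorem hasDerivAt_mul_geodesicOne (p v : D.N) (t : ℝ) :
    HasDerivAt (fun s => p * D.geodesicOne v s)
      (D.leftDeriv (p * D.geodesicOne v t) (v - t • D.connection v v)) t := by
  have h := ((D.differentiable_mul_left p _).hasFDerivAt).comp_hasDerivAt t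
    (D.hasDerivAt_geodesicOne v t)
  rw [fderiv_mul_left, maurerCartan_leftDeriv] at h
  exact h

/-- The left translate of a geodesic solves the geodesic equation, since the components of its
velocity in the left-invariant frame are unchanged. -/
theorem geodesic_mul_geodesicOne (p v : D.N) (t : ℝ) :
    deriv (deriv fun s => p * D.geodesicOne v s) t
      + frameChristoffel D.maurerCartan D.leftDeriv D.connection (p * D.geodesicOne v t)
          (deriv (fun s => p * D.geodesicOne v s) t)
          (deriv (fun s => p * D.geodesicOne v s) t) = 0 := by
  have hξ : HasDerivAt (fun s : ℝ => v - s • D.connection v v) (-D.connection v v) t := by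
    simpa using ((hasDerivAt_id t).smul_const (D.connection v v)).const_sub v
  have hc := D.hasDerivAt_mul_geodesicOne p v
  generalize hcdef : (fun s => p * D.geodesicOne v s) = c at hc ⊢
  have hcs : ∀ s, p * D.geodesicOne v s = c s := fun s => congrFun hcdef s
  simp only [hcs] at hc ⊢
  have hcd : deriv c = fun s => D.leftDeriv (c s) (v - s • D.connection v v) :=
    funext fun s => (hc s).deriv
  have hL : DifferentiableAt ℝ D.leftDeriv (c t) :=
    D.contDiff_leftDeriv.differentiable (by simp) (c t)
  have h2 := (hL.hasFDerivAt.comp_hasDerivAt t (hc t)).clm_apply hξ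
  have h3 : DifferentiableAt ℝ (deriv c) t := by
    rw [hcd]
    exact h2.differentiableAt
  refine D.isTorsionFreeCoframe.geodesic_of_coframe (c := c) (c' := deriv c)
    (ξ := fun s => v - s • D.connection v v) ?_ h3.hasDerivAt (fun s => ?_) ?_
  · exact (hc t).differentiableAt.hasDerivAt
  · rw [hcd]
    exact D.maurerCartan_leftDeriv _ _
  · rw [connection_velocity]
    exact hξ

end AffineSymplecticPair

end

noncomputable section

open Filter Topology

/-! ### Neutral signature -/

theorem sigPos_eq_sigNeg_of_antiisometry {W : Type*} [AddCommGroup W] [Module ℝ W]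
    [FiniteDimensional ℝ W] (Q : QuadraticForm ℝ W) (A : W →ₗ[ℝ] W) (hA : ∀ u, A (A u) = u)
    (hQ : ∀ u, Q (A u) = -Q u) : sigPos Q = sigNeg Q := by
  rw [← sigPos_neg]
  refine QuadraticMap.Equivalent.sigPos_eq ⟨?_⟩
  exact ⟨LinearEquiv.ofInvolutive A hA, fun u => by
    change -Q (A u) = Q u
    rw [hQ, neg_neg]⟩

theorem radical_eq_bot_of_nondegenerate {W : Type*} [AddCommGroup W] [Module ℝ W]
    (b : W →ₗ[ℝ] W →ₗ[ℝ] ℝ) (hs : ∀ u v, b u v = b v u) (hn : ∀ u, (∀ v, b u v = 0) → u = 0) :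
    (LinearMap.BilinMap.toQuadraticMap b).radical = ⊥ := by
  rw [eq_bot_iff]
  intro u hu
  rw [Submodule.mem_bot]
  apply hn
  intro v
  have h := QuadraticMap.radical_le_ker_polarBilin hu
  rw [LinearMap.mem_ker] at h
  have h1 := LinearMap.congr_fun h v
  simp only [QuadraticMap.polarBilin_apply_apply, QuadraticMap.polar,
    LinearMap.BilinMap.toQuadraticMap_apply, map_add, LinearMap.add_apply,
    LinearMap.zero_apply] at h1
  have := hs u v
  linarith

/-- A non-degenerate symmetric form with an anti-isometric involution has neutral signature. -/
theorem two_mul_sigPos_of_antiisometry {W : Type*} [AddCommGroup W] [Module ℝ W]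
    [FiniteDimensional ℝ W] (b : W →ₗ[ℝ] W →ₗ[ℝ] ℝ) (hs : ∀ u v, b u v = b v u)
    (hn : ∀ u, (∀ v, b u v = 0) → u = 0) (A : W →ₗ[ℝ] W) (hA : ∀ u, A (A u) = u)
    (hb : ∀ u v, b (A u) (A v) = -b u v) :
    2 * sigPos (LinearMap.BilinMap.toQuadraticMap b) = Module.finrank ℝ W ∧
      2 * sigNeg (LinearMap.BilinMap.toQuadraticMap b) = Module.finrank ℝ W := by
  have h1 := sigPos_eq_sigNeg_of_antiisometry (LinearMap.BilinMap.toQuadraticMap b) A hA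
    fun u => hb u u
  have h2 := QuadraticForm.sigPos_add_sigNeg_add_radical
    (Q := LinearMap.BilinMap.toQuadraticMap b)
  rw [radical_eq_bot_of_nondegenerate b hs hn, finrank_bot] at h2
  omega

/-! ### Manifolds locally modelled on the group -/

theorem coordChristoffel_congr {E : Type*} [NormedAddCommGroup E] [NormedSpace ℝ E]
    {h h' : E → E →L[ℝ] E →L[ℝ] ℝ} {y : E} (hh : h =ᶠ[𝓝 y] h') (u v : E) :
    coordChristoffel h y u v = coordChristoffel h' y u v := by
  rw [coordChristoffel, coordChristoffel, coordKoszul, coordKoszul, hh.fderiv_eq, hh.self_of_nhds]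

theorem mfderiv_eq_fderiv_chartAt_comp {E M : Type*} [NormedAddCommGroup E] [NormedSpace ℝ E]
    [TopologicalSpace M] [ChartedSpace E M] {f : E → M} {y : E}
    (hf : MDifferentiableAt 𝓘(ℝ, E) 𝓘(ℝ, E) f y) :
    mfderiv 𝓘(ℝ, E) 𝓘(ℝ, E) f y = fderiv ℝ (fun z => chartAt E (f y) (f z)) y := by
  rw [hf.mfderiv]
  simp only [writtenInExtChartAt, extChartAt, mfld_simps, fderivWithin_univ]
  rfl

theorem chartCoframe_chartFrame {E M : Type*} [NormedAddCommGroup E] [NormedSpace ℝ E]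
    [TopologicalSpace M] [ChartedSpace E M] [IsManifold 𝓘(ℝ, E) ∞ M] {x₀ : M} {y : E}
    (hy : y ∈ (chartAt E x₀).target) (u : E) :
    chartCoframe x₀ y (chartFrame x₀ y u) = u := by
  have : IsManifold 𝓘(ℝ, E) 1 M := .of_le (n := ∞) (by simp)
  exact DFunLike.congr_fun ((mdifferentiable_chart (I := 𝓘(ℝ, E)) x₀).comp_symm_deriv hy) u

namespace AffineSymplecticPair
section Basic
variable {V : Type*} [NormedAddCommGroup V] [NormedSpace ℝ V] (D : AffineSymplecticPair V)
variable {M : Type*} [TopologicalSpace M] [ChartedSpace D.N M]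

/-- The map `π` from `N_{∇,∇'}` to `M` is locally inverse to the charts of `M`, up to left
translations: it agrees with the inverse of each chart, and near each point the composition of `π`
with a chart is a left translation. -/
structure IsLocalModel (π : D.N → M) : Prop where
  continuous : Continuous π
  symm_eq : ∀ x₀ : M, ∀ y ∈ (chartAt D.N x₀).target, (chartAt D.N x₀).symm y = π y
  chart_eq : ∀ (x₀ : M) (y : D.N), π y ∈ (chartAt D.N x₀).source →
    ∃ p : D.N, ∀ᶠ z in 𝓝 y, chartAt D.N x₀ (π z) = p * z

theorem isLocalModel_id : D.IsLocalModel (id : D.N → D.N) where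
  continuous := continuous_id
  symm_eq _ _ _ := rfl
  chart_eq _ _ _ := ⟨1, Eventually.of_forall fun z => (one_mul z).symm⟩

variable {D} in
/-- The derivative of `π` in the preferred charts. -/
def modelDeriv (π : D.N → M) (y : D.N) : D.N →L[ℝ] D.N := mfderiv 𝓘(ℝ, D.N) 𝓘(ℝ, D.N) π y

variable {D}
namespace IsLocalModel

variable {π : D.N → M} (hπ : D.IsLocalModel π)
include hπ

theorem map_chart (x : M) : π (chartAt D.N x x) = x := by
  rw [← hπ.symm_eq x _ (mem_chart_target _ x)]
  exact (chartAt D.N x).left_inv (mem_chart_source _ x)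

theorem chart_map {x₀ : M} {y : D.N} (hy : y ∈ (chartAt D.N x₀).target) :
    chartAt D.N x₀ (π y) = y := by
  rw [← hπ.symm_eq x₀ y hy, (chartAt D.N x₀).right_inv hy]

theorem chartFrame_eq {x₀ : M} {y : D.N} (hy : y ∈ (chartAt D.N x₀).target) :
    chartFrame x₀ y = modelDeriv π y := by
  have h : (chartAt D.N x₀).symm =ᶠ[𝓝 y] π :=
    Filter.eventuallyEq_of_mem ((chartAt D.N x₀).open_target.mem_nhds hy)
      (hπ.symm_eq x₀)
  exact h.mfderiv_eq

end IsLocalModel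
end Basic

section Fields
variable {V : Type*} [NormedAddCommGroup V] [NormedSpace ℝ V] [FiniteDimensional ℝ V]
variable (D : AffineSymplecticPair V)

variable (M : Type*) [TopologicalSpace M] [ChartedSpace D.N M]

/-- The metric of `N_{∇,∇'}`, read in the preferred charts of a manifold modelled on it. -/
def metricOn : BilinField D.N M := fun x => D.metric (chartAt D.N x x)

/-- The complex structure of `N_{∇,∇'}`, read in the preferred charts of a manifold modelled on
it. -/
def JOn : EndoField D.N M := fun x => D.J (chartAt D.N x x)

/-- The product structure of `N_{∇,∇'}`, read in the preferred charts of a manifold modelled on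
it. -/
def EOn : EndoField D.N M := fun x => D.E (chartAt D.N x x)

variable {D} in
theorem coframeEndo_coframeEndo (A A' : D.N →L[ℝ] D.N) (p u : D.N) :
    coframeEndo D.maurerCartan D.leftDeriv A p (coframeEndo D.maurerCartan D.leftDeriv A' p u)
      = coframeEndo D.maurerCartan D.leftDeriv (A ∘L A') p u := by
  simp only [coframeEndo_apply, maurerCartan_leftDeriv, ContinuousLinearMap.comp_apply]

theorem coframeEndo_JN_JN (p u : D.N) :
    coframeEndo D.maurerCartan D.leftDeriv D.JN p
      (coframeEndo D.maurerCartan D.leftDeriv D.JN p u) = -u := by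
  simp only [coframeEndo_apply, maurerCartan_leftDeriv, JN_JN, map_neg, leftDeriv_maurerCartan]

theorem coframeEndo_EN_EN (p u : D.N) :
    coframeEndo D.maurerCartan D.leftDeriv D.EN p
      (coframeEndo D.maurerCartan D.leftDeriv D.EN p u) = u := by
  simp only [coframeEndo_apply, maurerCartan_leftDeriv, EN_EN, leftDeriv_maurerCartan]

theorem coframeEndo_JN_EN (p u : D.N) :
    coframeEndo D.maurerCartan D.leftDeriv D.JN p
        (coframeEndo D.maurerCartan D.leftDeriv D.EN p u)
      = -coframeEndo D.maurerCartan D.leftDeriv D.EN p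
        (coframeEndo D.maurerCartan D.leftDeriv D.JN p u) := by
  simp only [coframeEndo_apply, maurerCartan_leftDeriv, JN_EN, map_neg]

theorem coframeForm_JN (p u v : D.N) :
    coframeForm D.maurerCartan D.metricN p (coframeEndo D.maurerCartan D.leftDeriv D.JN p u)
        (coframeEndo D.maurerCartan D.leftDeriv D.JN p v)
      = coframeForm D.maurerCartan D.metricN p u v := by
  simp only [coframeForm_apply, coframeEndo_apply, maurerCartan_leftDeriv, metricN_JN]

theorem coframeForm_EN (p u v : D.N) :
    coframeForm D.maurerCartan D.metricN p (coframeEndo D.maurerCartan D.leftDeriv D.EN p u)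
        (coframeEndo D.maurerCartan D.leftDeriv D.EN p v)
      = -coframeForm D.maurerCartan D.metricN p u v := by
  simp only [coframeForm_apply, coframeEndo_apply, maurerCartan_leftDeriv, metricN_EN]

theorem coframeForm_coframeEndo (b : D.N →L[ℝ] D.N →L[ℝ] ℝ) (A : D.N →L[ℝ] D.N) (p : D.N) :
    coframeForm D.maurerCartan b p ∘L coframeEndo D.maurerCartan D.leftDeriv A p
      = coframeForm D.maurerCartan (b ∘L A) p := by
  ext u v
  simp only [ContinuousLinearMap.comp_apply, coframeForm_apply, coframeEndo_apply,
    maurerCartan_leftDeriv]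

end Fields

namespace IsLocalModel

variable {V : Type*} [NormedAddCommGroup V] [NormedSpace ℝ V] [FiniteDimensional ℝ V]
variable {D : AffineSymplecticPair V} {M : Type*} [TopologicalSpace M] [ChartedSpace D.N M]
variable {π : D.N → M} (hπ : D.IsLocalModel π)
include hπ

/-- The manifold structure is smooth, as the transition maps are locally left translations. -/
theorem isManifold (hatlas : ∀ e ∈ atlas D.N M, ∃ x : M, e = chartAt D.N x) :
    IsManifold 𝓘(ℝ, D.N) ∞ M := by
  apply isManifold_of_contDiffOn
  intro e e' he he'
  obtain ⟨x, rfl⟩ := hatlas e he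
  obtain ⟨x', rfl⟩ := hatlas e' he'
  simp only [mfld_simps]
  intro y hy
  have hy1 : y ∈ (chartAt D.N x).target := hy.1
  have hy2 : π y ∈ (chartAt D.N x').source := by
    rw [← hπ.symm_eq x y hy1]
    exact hy.2
  obtain ⟨p, hp⟩ := hπ.chart_eq x' y hy2
  have h1 : (chartAt D.N x' ∘ (chartAt D.N x).symm) =ᶠ[𝓝 y] fun z => p * z := by
    filter_upwards [hp, (chartAt D.N x).open_target.mem_nhds hy1] with z hz hz'
    rw [Function.comp_apply, hπ.symm_eq x z hz', hz]
  exact ((D.contDiff_mul_left p).contDiffAt.congr_of_eventuallyEq h1).contDiffWithinAt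

section
variable [IsManifold 𝓘(ℝ, D.N) ∞ M]

theorem contMDiff : ContMDiff 𝓘(ℝ, D.N) 𝓘(ℝ, D.N) ∞ π := by
  intro y
  obtain ⟨p, hp⟩ := hπ.chart_eq (π y) y (mem_chart_source _ _)
  have hp0 := hp.self_of_nhds
  have h1 : ContMDiffAt 𝓘(ℝ, D.N) 𝓘(ℝ, D.N) ∞ (chartAt D.N (π y)).symm (p * y) := by
    refine (contMDiffOn_chart_symm (x := π y)).contMDiffAt ?_
    rw [← hp0]
    exact (chartAt D.N (π y)).open_target.mem_nhds (mem_chart_target _ _)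
  have h2 : ContMDiffAt 𝓘(ℝ, D.N) 𝓘(ℝ, D.N) ∞ (fun z : D.N => p * z) y :=
    (D.contDiff_mul_left p).contMDiff y
  refine (h1.comp y h2).congr_of_eventuallyEq ?_
  filter_upwards [hp, hπ.continuous.continuousAt.preimage_mem_nhds
    ((chartAt D.N (π y)).open_source.mem_nhds (mem_chart_source _ _))] with z hz hz'
  rw [Function.comp_apply, ← hz, (chartAt D.N (π y)).left_inv hz']

/-- In the preferred charts, the derivative of `π` is the derivative of a left translation. -/
theorem exists_mfderiv_eq (y : D.N) : ∃ p : D.N, chartAt D.N (π y) (π y) = p * y ∧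
    modelDeriv π y = D.leftDeriv (p * y) ∘L D.maurerCartan y := by
  obtain ⟨p, hp⟩ := hπ.chart_eq (π y) y (mem_chart_source _ _)
  refine ⟨p, hp.self_of_nhds, ?_⟩
  ext1 u
  rw [modelDeriv, mfderiv_eq_fderiv_chartAt_comp ((hπ.contMDiff y).mdifferentiableAt (by simp)),
    ContinuousLinearMap.comp_apply, ← fderiv_mul_left]
  exact DFunLike.congr_fun (Filter.EventuallyEq.fderiv_eq hp) u

theorem modelDeriv_coframeEndo (y u : D.N) (A : D.N →L[ℝ] D.N) :
    coframeEndo D.maurerCartan D.leftDeriv A (chartAt D.N (π y) (π y)) (modelDeriv π y u)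
      = modelDeriv π y (coframeEndo D.maurerCartan D.leftDeriv A y u) := by
  obtain ⟨p, hp, h⟩ := hπ.exists_mfderiv_eq y
  simp only [h, hp, coframeEndo_apply, ContinuousLinearMap.comp_apply, maurerCartan_leftDeriv]

theorem coframeForm_modelDeriv (y u v : D.N) (b : D.N →L[ℝ] D.N →L[ℝ] ℝ) :
    coframeForm D.maurerCartan b (chartAt D.N (π y) (π y)) (modelDeriv π y u)
      (modelDeriv π y v) = coframeForm D.maurerCartan b y u v := by
  obtain ⟨p, hp, h⟩ := hπ.exists_mfderiv_eq y
  simp only [h, hp, coframeForm_apply, ContinuousLinearMap.comp_apply, maurerCartan_leftDeriv]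

/-- The fields on `M` are induced by those of `N_{∇,∇'}` through `π`. -/
theorem isInducedThrough :
    IsInducedThrough π D.metric D.J D.E (D.metricOn M) (D.JOn M) (D.EOn M) where
  metric y u v := hπ.coframeForm_modelDeriv y u v D.metricN
  map_J y u := hπ.modelDeriv_coframeEndo y u D.JN
  map_P y u := hπ.modelDeriv_coframeEndo y u D.EN

theorem inChart_coframeForm (b : D.N →L[ℝ] D.N →L[ℝ] ℝ) {g : BilinField D.N M}
    (hg : ∀ x, g x = coframeForm D.maurerCartan b (chartAt D.N x x)) {x₀ : M} {y : D.N}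
    (hy : y ∈ (chartAt D.N x₀).target) :
    g.inChart x₀ y = coframeForm D.maurerCartan b y := by
  ext u v
  rw [BilinField.inChart, hg, hπ.chartFrame_eq hy, hπ.symm_eq x₀ y hy]
  exact hπ.coframeForm_modelDeriv y u v b

theorem inChart_coframeEndo (A : D.N →L[ℝ] D.N) {J : EndoField D.N M}
    (hJ : ∀ x, J x = coframeEndo D.maurerCartan D.leftDeriv A (chartAt D.N x x)) {x₀ : M} {y : D.N}
    (hy : y ∈ (chartAt D.N x₀).target) :
    J.inChart x₀ y = coframeEndo D.maurerCartan D.leftDeriv A y := by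
  ext1 u
  have h := chartCoframe_chartFrame hy (coframeEndo D.maurerCartan D.leftDeriv A y u)
  rw [EndoField.inChart, hJ]
  rw [hπ.chartFrame_eq hy] at h ⊢
  refine Eq.trans (congrArg (fun w : D.N => (chartCoframe x₀ y : D.N →L[ℝ] D.N) w) ?_) h
  rw [hπ.symm_eq x₀ y hy]
  exact hπ.modelDeriv_coframeEndo y u A

theorem inChart_metricOn {x₀ : M} {y : D.N} (hy : y ∈ (chartAt D.N x₀).target) :
    (D.metricOn M).inChart x₀ y = coframeForm D.maurerCartan D.metricN y :=
  hπ.inChart_coframeForm D.metricN (fun _ => rfl) hy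

theorem inChart_JOn {x₀ : M} {y : D.N} (hy : y ∈ (chartAt D.N x₀).target) :
    (D.JOn M).inChart x₀ y = coframeEndo D.maurerCartan D.leftDeriv D.JN y :=
  hπ.inChart_coframeEndo D.JN (fun _ => rfl) hy

theorem inChart_metricOn_eventuallyEq {x₀ : M} {y : D.N} (hy : y ∈ (chartAt D.N x₀).target) :
    (D.metricOn M).inChart x₀ =ᶠ[𝓝 y] coframeForm D.maurerCartan D.metricN :=
  Filter.eventuallyEq_of_mem ((chartAt D.N x₀).open_target.mem_nhds hy)
    fun _ => hπ.inChart_metricOn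

theorem coordChristoffel_metricOn {x₀ : M} {y : D.N} (hy : y ∈ (chartAt D.N x₀).target)
    (u v : D.N) : coordChristoffel ((D.metricOn M).inChart x₀) y u v
      = frameChristoffel D.maurerCartan D.leftDeriv D.connection y u v := by
  rw [coordChristoffel_congr (hπ.inChart_metricOn_eventuallyEq hy)]
  exact D.isTorsionFreeCoframe.coordChristoffel_eq D.isParallelForm_metricN D.metricN_symm
    D.metricN_nondegenerate y u v

theorem coordChristoffel_metricOn_eventually {x₀ : M} {y : D.N}
    (hy : y ∈ (chartAt D.N x₀).target) :
    ∀ᶠ z in 𝓝 y, ∀ u v, coordChristoffel ((D.metricOn M).inChart x₀) z u v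
      = frameChristoffel D.maurerCartan D.leftDeriv D.connection z u v := by
  filter_upwards [(chartAt D.N x₀).open_target.mem_nhds hy] with z hz
  exact hπ.coordChristoffel_metricOn hz

theorem isSmooth_coframeForm (b : D.N →L[ℝ] D.N →L[ℝ] ℝ) {g : BilinField D.N M}
    (hg : ∀ x, g x = coframeForm D.maurerCartan b (chartAt D.N x x)) : g.IsSmooth := fun _ =>
  (D.isTorsionFreeCoframe.contDiff_coframeForm b).contDiffOn.congr
    fun _ hy => hπ.inChart_coframeForm b hg hy

theorem isSmooth_coframeEndo (A : D.N →L[ℝ] D.N) {J : EndoField D.N M}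
    (hJ : ∀ x, J x = coframeEndo D.maurerCartan D.leftDeriv A (chartAt D.N x x)) :
    J.IsSmooth := fun _ =>
  (D.isTorsionFreeCoframe.contDiff_coframeEndo A).contDiffOn.congr
    fun _ hy => hπ.inChart_coframeEndo A hJ hy

theorem isClosedTwoForm_coframeForm {b : D.N →L[ℝ] D.N →L[ℝ] ℝ}
    (hb : IsParallelForm D.connection b) (hs : ∀ ξ η, b ξ η = -b η ξ) {g : BilinField D.N M}
    (hg : ∀ x, g x = coframeForm D.maurerCartan b (chartAt D.N x x)) : g.IsClosedTwoForm := by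
  refine ⟨hπ.isSmooth_coframeForm b hg, fun x₀ => ?_⟩
  obtain ⟨Ω, hΩ, hd⟩ := D.isTorsionFreeCoframe.exists_extDeriv_coframeForm_eq_zero hb hs
  refine ⟨Ω, fun y hy => ⟨fun u v => ?_, hd y⟩⟩
  rw [hΩ, hπ.inChart_coframeForm b hg hy]

theorem isNeutralMetric : (D.metricOn M).IsNeutralMetric := by
  have hs : ∀ p u v : D.N, coframeForm D.maurerCartan D.metricN p u v
      = coframeForm D.maurerCartan D.metricN p v u := fun p u v => D.metricN_symm _ _
  have hn : ∀ p u : D.N, (∀ v, coframeForm D.maurerCartan D.metricN p u v = 0) → u = 0 := by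
    intro p u h
    apply D.isTorsionFreeCoframe.coframe_injective p
    rw [map_zero]
    apply D.metricN_nondegenerate
    intro v
    have := h (D.leftDeriv p v)
    rwa [coframeForm_apply, maurerCartan_leftDeriv] at this
  have hsig : ∀ p : D.N, _ := fun p => two_mul_sigPos_of_antiisometry
    (coframeForm D.maurerCartan D.metricN p).toLinearMap₁₂ (hs p) (hn p)
    (coframeEndo D.maurerCartan D.leftDeriv D.EN p).toLinearMap
    (D.coframeEndo_EN_EN p) (D.coframeForm_EN p)
  exact
    { smooth := hπ.isSmooth_coframeForm D.metricN fun _ => rfl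
      symm := fun x u v => hs _ u v
      nondegenerate := fun x u h => hn _ u h
      sigPos := fun x => (hsig (chartAt D.N x x)).1
      sigNeg := fun x => (hsig (chartAt D.N x x)).2 }

end

end IsLocalModel
end AffineSymplecticPair

/-! ### The induced hypersymplectic structure -/

namespace AffineSymplecticPair
namespace IsLocalModel
variable {V : Type*} [NormedAddCommGroup V] [NormedSpace ℝ V] [FiniteDimensional ℝ V]
variable {D : AffineSymplecticPair V} {M : Type*} [TopologicalSpace M] [ChartedSpace D.N M]
variable {π : D.N → M} (hπ : D.IsLocalModel π)
include hπ
variable [IsManifold 𝓘(ℝ, D.N) ∞ M]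

theorem isClosedTwoForm_comp {A : D.N →L[ℝ] D.N}
    (hA : ∀ ξ η, D.connection ξ (A η) = A (D.connection ξ η))
    (hs : ∀ ξ η, D.metricN (A ξ) η = -D.metricN (A η) ξ) {J : EndoField D.N M}
    (hJ : ∀ x, J x = coframeEndo D.maurerCartan D.leftDeriv A (chartAt D.N x x)) :
    ((D.metricOn M).comp J).IsClosedTwoForm := by
  refine hπ.isClosedTwoForm_coframeForm (isParallelForm_comp D.isParallelForm_metricN hA) hs
    fun x => ?_
  rw [BilinField.comp, hJ]
  exact D.coframeForm_coframeEndo D.metricN A _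

theorem isHypersymplectic : IsHypersymplectic (D.metricOn M) (D.JOn M) (D.EOn M) where
  metric := hπ.isNeutralMetric
  smooth_J := hπ.isSmooth_coframeEndo D.JN fun _ => rfl
  smooth_P := hπ.isSmooth_coframeEndo D.EN fun _ => rfl
  J_sq x u := D.coframeEndo_JN_JN _ u
  P_sq x u := D.coframeEndo_EN_EN _ u
  anticomm x u := D.coframeEndo_JN_EN _ u
  metric_J x u v := D.coframeForm_JN _ u v
  metric_P x u v := D.coframeForm_EN _ u v
  closed₁ := hπ.isClosedTwoForm_comp D.connection_JN
    (fun ξ η => by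
      simp only [metricN_apply, JN_apply, mkN_fst, mkN_snd, map_neg, LinearMap.neg_apply,
        D.symplectic.skew ξ.1, D.symplectic.skew ξ.2]
      ring) fun _ => rfl
  closed₂ := hπ.isClosedTwoForm_comp D.connection_EN
    (fun ξ η => by
      simp only [metricN_apply, EN_apply, mkN_fst, mkN_snd, map_neg, LinearMap.neg_apply,
        D.symplectic.skew ξ.1, D.symplectic.skew ξ.2]
      ring) fun _ => rfl
  closed₃ := hπ.isClosedTwoForm_comp (A := D.JN ∘L D.EN)
    (fun ξ η => by
      simp only [ContinuousLinearMap.comp_apply, connection_JN, connection_EN])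
    (fun ξ η => by
      simp only [ContinuousLinearMap.comp_apply, metricN_apply, JN_apply, EN_apply, mkN_fst,
        mkN_snd, map_neg, LinearMap.neg_apply, D.symplectic.skew ξ.1, D.symplectic.skew ξ.2]
      ring)
    fun x => ContinuousLinearMap.ext fun u => coframeEndo_coframeEndo D.JN D.EN _ u

theorem isIntegrable : (D.JOn M).IsIntegrable := by
  intro x₀ X Y hX hY y hy
  have hopen := (chartAt D.N x₀).open_target.mem_nhds hy
  have hX' : DifferentiableAt ℝ X y := (hX.differentiableOn (by simp)).differentiableAt hopen
  have hY' : DifferentiableAt ℝ Y y := (hY.differentiableOn (by simp)).differentiableAt hopen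
  have hJ : ∀ Z : D.N → D.N, (fun z => (D.JOn M).inChart x₀ z (Z z))
      =ᶠ[𝓝 y] fun z => coframeEndo D.maurerCartan D.leftDeriv D.JN z (Z z) := by
    intro Z
    filter_upwards [hopen] with z hz
    rw [hπ.inChart_JOn hz]
  rw [(hJ X).lieBracket_vectorField_eq (hJ Y),
    (hJ X).lieBracket_vectorField_eq (EventuallyEq.refl (𝓝 y) Y),
    (EventuallyEq.refl (𝓝 y) X).lieBracket_vectorField_eq (hJ Y), hπ.inChart_JOn hy]
  exact D.isTorsionFreeCoframe.nijenhuis_coframeEndo D.connection_JN D.JN_JN hX' hY'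

theorem isNeutralKahler : IsNeutralKahler (D.metricOn M) (D.JOn M) where
  metric := hπ.isNeutralMetric
  smooth_J := hπ.isHypersymplectic.smooth_J
  J_sq := hπ.isHypersymplectic.J_sq
  integrable := hπ.isIntegrable
  hermitian := hπ.isHypersymplectic.metric_J
  closed := hπ.isHypersymplectic.closed₁

theorem isRicciFlat : (D.metricOn M).IsRicciFlat := fun _ _ hy v w =>
  D.coordRicci_eq_zero (hπ.coordChristoffel_metricOn_eventually hy) v w

theorem coordCurvature_metricOn {x₀ : M} {y : D.N} (hy : y ∈ (chartAt D.N x₀).target)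
    (u v w : D.N) : coordCurvature ((D.metricOn M).inChart x₀) y u v w
      = D.leftDeriv y (frameCurvature D.connection (D.maurerCartan y u) (D.maurerCartan y v)
        (D.maurerCartan y w)) :=
  D.isTorsionFreeCoframe.coordCurvature_eq (hπ.coordChristoffel_metricOn_eventually hy) u v w

theorem isFlat_iff : (D.metricOn M).IsFlat ↔ ∀ x y z, D.cubic x y z = 0 := by
  constructor
  · intro h x y z
    have hp := mem_chart_target D.N (π 1)
    set p := chartAt D.N (π 1) (π 1)
    -- the first component of `R(x, y') z` is a multiple of `cubic x y z`
    have h1 := h (π 1) p hp (D.leftDeriv p (D.mkN x 0)) (D.leftDeriv p (D.mkN 0 y))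
      (D.leftDeriv p (D.mkN z 0))
    rw [hπ.coordCurvature_metricOn hp, maurerCartan_leftDeriv, maurerCartan_leftDeriv,
      maurerCartan_leftDeriv] at h1
    have h2 := congrArg (D.maurerCartan p) h1
    rw [maurerCartan_leftDeriv, map_zero, frameCurvature_connection] at h2
    have h3 : (4 : ℝ) • (D.cubic x y z - D.cubic 0 0 z) = 0 := congrArg Prod.fst h2
    rw [smul_eq_zero_iff_right (by norm_num), cubic, cubic, map_zero, LinearMap.zero_apply,
      sub_zero] at h3
    exact h3
  · intro h x₀ y hy u v w
    rw [hπ.coordCurvature_metricOn hy, frameCurvature_connection]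
    simp only [h, sub_zero]
    rw [show D.mkN (0 : V) 0 = 0 from rfl, smul_zero, map_zero]

/-- The geodesics of `M` are the images under `π` of left translates of geodesics through the
identity. -/
theorem isComplete : (D.metricOn M).IsComplete := by
  intro x v
  have hx := mem_chart_target D.N x
  have hpx := hπ.map_chart x
  generalize chartAt D.N x x = p at hx hpx
  set ξ := D.maurerCartan p v
  have hc0 : p * D.geodesicOne ξ 0 = p := by rw [geodesicOne_zero, mul_one]
  have hcd := D.hasDerivAt_mul_geodesicOne p ξ
  have hsm : ContDiff ℝ ∞ fun s => p * D.geodesicOne ξ s :=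
    (D.contDiff_mul_left p).comp (D.contDiff_geodesicOne ξ)
  refine ⟨fun s => π (p * D.geodesicOne ξ s), ⟨hπ.contMDiff.comp hsm.contMDiff, fun t => ?_⟩,
    ?_, ?_⟩
  -- in the chart around `γ t`, the curve is again a left translate of `geodesicOne ξ`
  · set y := p * D.geodesicOne ξ t with hy
    obtain ⟨q, hq⟩ := hπ.chart_eq (π y) y (mem_chart_source _ _)
    have h1 : (chartAt D.N (π y) ∘ fun s => π (p * D.geodesicOne ξ s))
        =ᶠ[𝓝 t] fun s => q * p * D.geodesicOne ξ s := by
      filter_upwards [(hcd t).continuousAt.eventually hq] with s hs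
      rw [Function.comp_apply, hs, mul_assoc]
    have h2 : chartAt D.N (π y) (π y) = q * p * D.geodesicOne ξ t := by
      rw [hq.self_of_nhds, hy, mul_assoc]
    rw [h1.deriv.deriv_eq, h1.deriv_eq,
      hπ.coordChristoffel_metricOn (mem_chart_target D.N (π y)), h2]
    exact D.geodesic_mul_geodesicOne (q * p) ξ t
  · change π (p * D.geodesicOne ξ 0) = x
    rw [hc0, hpx]
  · have h1 : (chartAt D.N x ∘ fun s => π (p * D.geodesicOne ξ s))
        =ᶠ[𝓝 0] fun s => p * D.geodesicOne ξ s := by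
      have h2 : (chartAt D.N x).target ∈ 𝓝 (p * D.geodesicOne ξ 0) := by
        rw [hc0]
        exact (chartAt D.N x).open_target.mem_nhds hx
      filter_upwards [(hcd 0).continuousAt.preimage_mem_nhds h2] with s hs
      exact hπ.chart_map hs
    rw [h1.deriv_eq, (hcd 0).deriv, hc0, zero_smul, sub_zero, leftDeriv_maurerCartan]

/-- Near `y`, the inverse of `π` is a chart followed by a left translation. -/
theorem isLocalDiffeomorph : IsLocalDiffeomorph 𝓘(ℝ, D.N) 𝓘(ℝ, D.N) ∞ π := by
  intro y
  obtain ⟨p, hp⟩ := hπ.chart_eq (π y) y (mem_chart_source _ _)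
  obtain ⟨U, hU, hUo, hyU⟩ := mem_nhds_iff.1 (hp.and (hπ.continuous.continuousAt.preimage_mem_nhds
    ((chartAt D.N (π y)).open_source.mem_nhds (mem_chart_source _ _))))
  set e := chartAt D.N (π y)
  have hinv : Continuous fun z : D.N => p⁻¹ * z := (D.contDiff_mul_left p⁻¹).continuous
  refine ⟨⟨⟨π, fun w => p⁻¹ * e w, U, e.source ∩ e ⁻¹' ((fun z : D.N => p⁻¹ * z) ⁻¹' U),
    ?_, ?_, ?_, ?_⟩, hUo, ?_, hπ.contMDiff.contMDiffOn, ?_⟩, hyU, fun _ _ => rfl⟩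
  · intro z hz
    refine ⟨(hU hz).2, ?_⟩
    simp only [Set.mem_preimage, show e (π z) = p * z from (hU hz).1, inv_mul_cancel_left]
    exact hz
  · intro w hw
    exact hw.2
  · intro z hz
    simp only [show e (π z) = p * z from (hU hz).1, inv_mul_cancel_left]
  · intro w hw
    have h := hU hw.2
    refine e.injOn h.2 hw.1 ?_
    simp only [show e (π (p⁻¹ * e w)) = p * (p⁻¹ * e w) from h.1, mul_inv_cancel_left]
  · exact e.isOpen_inter_preimage (hUo.preimage hinv)
  · refine ((D.contDiff_mul_left p⁻¹).contMDiff.comp_contMDiffOn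
      (contMDiffOn_chart (x := π y))).mono Set.inter_subset_left

end IsLocalModel
end AffineSymplecticPair

/-! ### Quotients by discrete subgroups -/

namespace AffineSymplecticPair

section Projection
variable {V : Type*} [AddCommGroup V] [Module ℝ V]

/-- The projection of `N_{∇,∇'}` to its quotient by the left translations by elements of `Γ`. -/
def proj (D : AffineSymplecticPair V) (Γ : Subgroup D.N) (p : D.N) :
    MulAction.orbitRel.Quotient Γ D.N := Quotient.mk _ p

theorem proj_eq_iff {D : AffineSymplecticPair V} {Γ : Subgroup D.N} {p q : D.N} :
    D.proj Γ p = D.proj Γ q ↔ ∃ γ ∈ Γ, γ * q = p := by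
  rw [proj, proj, Quotient.eq]
  change p ∈ MulAction.orbit Γ q ↔ _
  rw [MulAction.mem_orbit_iff]
  exact ⟨fun ⟨γ, hγ⟩ => ⟨γ, γ.2, hγ⟩, fun ⟨γ, hγ, h⟩ => ⟨⟨γ, hγ⟩, h⟩⟩

end Projection

variable {V : Type*} [NormedAddCommGroup V] [NormedSpace ℝ V] [FiniteDimensional ℝ V]
variable {D : AffineSymplecticPair V}

instance : IsTopologicalGroup D.N := topologicalGroup_of_lieGroup 𝓘(ℝ, D.N) ∞

variable {Γ : Subgroup D.N}

theorem isLocalHomeomorph_proj [DiscreteTopology Γ] : IsLocalHomeomorph (D.proj Γ) := by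
  have h : IsQuotientCoveringMap (D.proj Γ) Γ :=
    isQuotientMap_quotient_mk'.isQuotientCoveringMap_of_subgroup Γ
      (isDiscrete_iff_discreteTopology.2 inferInstance) (by
        intro p q
        refine eq_comm.trans (proj_eq_iff.trans ⟨?_, fun h => ⟨q * p⁻¹, h, by group⟩⟩)
        rintro ⟨γ, hγ, rfl⟩
        simpa using hγ)
  exact h.isCoveringMap.isLocalHomeomorph

/-- The action of a discrete subgroup by left translations is properly discontinuous. -/
theorem t2Space_quotient [DiscreteTopology Γ] : T2Space (MulAction.orbitRel.Quotient Γ D.N) := by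
  have := Subgroup.properlyDiscontinuousSMul_of_tendsto_cofinite Γ
    (Γ.tendsto_coe_cofinite_of_discrete (isDiscrete_iff_discreteTopology.2 inferInstance))
  exact t2Space_of_properlyDiscontinuousSMul_of_t2Space

/-- The inversion of `N_{∇,∇'}` identifies its quotients by right and by left translations. -/
theorem compactSpace_quotient [CompactSpace (D.N ⧸ Γ)] :
    CompactSpace (MulAction.orbitRel.Quotient Γ D.N) := by
  have hc : Continuous fun p : D.N => D.proj Γ p⁻¹ :=
    continuous_quotient_mk'.comp continuous_inv
  have hrel : ∀ p q : D.N, (QuotientGroup.leftRel Γ) p q → D.proj Γ p⁻¹ = D.proj Γ q⁻¹ := by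
    intro p q h
    exact proj_eq_iff.2 ⟨p⁻¹ * q, QuotientGroup.leftRel_apply.1 h, by group⟩
  have hf : Continuous (Quotient.lift (fun p : D.N => D.proj Γ p⁻¹) hrel) := hc.quotient_lift hrel
  have hs : Function.Surjective (Quotient.lift (fun p : D.N => D.proj Γ p⁻¹) hrel) := by
    intro x
    obtain ⟨p, rfl⟩ := Quotient.exists_rep x
    exact ⟨Quotient.mk _ p⁻¹, congrArg (D.proj Γ) (inv_inv p)⟩
  have : CompactSpace (Quotient (QuotientGroup.leftRel Γ)) :=
    inferInstanceAs (CompactSpace (D.N ⧸ Γ))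
  exact hs.compactSpace hf

variable [DiscreteTopology Γ]

/-- A local homeomorphism which agrees with the projection to the quotient by `Γ` and whose image
contains `x`. -/
def projChart (x : MulAction.orbitRel.Quotient Γ D.N) :
    OpenPartialHomeomorph D.N (MulAction.orbitRel.Quotient Γ D.N) :=
  (isLocalHomeomorph_proj (Γ := Γ) x.out).choose

theorem projChart_apply (x : MulAction.orbitRel.Quotient Γ D.N) (p : D.N) :
    projChart x p = D.proj Γ p :=
  (congrFun (isLocalHomeomorph_proj (Γ := Γ) x.out).choose_spec.2 p).symm

theorem mem_projChart_target (x : MulAction.orbitRel.Quotient Γ D.N) :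
    x ∈ (projChart x).target := by
  have h := (projChart x).map_source (isLocalHomeomorph_proj (Γ := Γ) x.out).choose_spec.1
  rwa [projChart_apply, proj, Quotient.out_eq] at h

variable (Γ) in
/-- The charts of the quotient by `Γ` are the local inverses of the projection. -/
@[reducible] def quotientChartedSpace :
    ChartedSpace D.N (MulAction.orbitRel.Quotient Γ D.N) where
  atlas := Set.range fun x => (projChart x).symm
  chartAt x := (projChart x).symm
  mem_chart_source := mem_projChart_target
  chart_mem_atlas x := ⟨x, rfl⟩

theorem isLocalModel_proj : letI := quotientChartedSpace Γ; D.IsLocalModel (D.proj Γ) := by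
  let := quotientChartedSpace Γ
  refine ⟨continuous_quotient_mk', fun x₀ y _ => projChart_apply x₀ y, fun x₀ y hy => ?_⟩
  obtain ⟨γ, hγ, hy'⟩ : ∃ γ ∈ Γ, γ * y = (projChart x₀).symm (D.proj Γ y) := by
    rw [← proj_eq_iff, ← projChart_apply x₀, (projChart x₀).right_inv hy]
  refine ⟨γ, ?_⟩
  have hcont : Continuous fun z : D.N => γ * z := continuous_const_mul γ
  have hmem : γ * y ∈ (projChart x₀).source := by
    rw [hy']
    exact (projChart x₀).map_target hy
  filter_upwards [hcont.continuousAt.preimage_mem_nhds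
    ((projChart x₀).open_source.mem_nhds hmem)] with z hz
  change (projChart x₀).symm (D.proj Γ z) = γ * z
  have hz' : γ * z ∈ (projChart x₀).source := hz
  have h : D.proj Γ z = projChart x₀ (γ * z) := by
    rw [projChart_apply]
    exact (proj_eq_iff.2 ⟨γ, hγ, rfl⟩).symm
  rw [h, (projChart x₀).left_inv hz']

theorem isManifold_quotient :
    letI := quotientChartedSpace Γ
    IsManifold 𝓘(ℝ, D.N) ∞ (MulAction.orbitRel.Quotient Γ D.N) := by
  let := quotientChartedSpace Γ
  refine isLocalModel_proj.isManifold ?_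
  rintro e ⟨x, rfl⟩
  exact ⟨x, rfl⟩

end AffineSymplecticPair

end

noncomputable section

/-! ### The Lie bracket and the nilpotency class -/

theorem lowerCentralSeries_eq_bot_iff {L : Type*} [LieRing L] [LieAlgebra ℝ L] (n : ℕ) :
    LieModule.lowerCentralSeries ℝ L L n = ⊥ ↔ (⊥ : LieSubmodule ℝ L L).ucs n = ⊤ := by
  rw [LieSubmodule.ucs_eq_top_iff, le_bot_iff]

namespace AffineSymplecticPair

section LieBracket
variable {V : Type*} [NormedAddCommGroup V] [NormedSpace ℝ V] (D : AffineSymplecticPair V)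

theorem mulInvariantVectorField_eq (u : GroupLieAlgebra 𝓘(ℝ, D.N) D.N) (p : D.N) :
    mulInvariantVectorField u p = D.leftDeriv p u := by
  rw [mulInvariantVectorField, mfderiv_eq_fderiv]
  rfl

variable [FiniteDimensional ℝ V]

theorem fderiv_leftDeriv_zero_apply (u v : D.N) :
    fderiv ℝ (fun p => D.leftDeriv p v) 0 u = D.mkN (D.nabla' v.1 u.2) (-D.nabla u.2 v.1) := by
  have hd : Differentiable ℝ D.leftDeriv := D.contDiff_leftDeriv.differentiable (by simp)
  refine fderiv_apply_eq_of_quadratic ((hd 0).clm_apply (differentiableAt_const v))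
    (b := D.mkN 0 (-(1 / 2 : ℝ) • D.nabla u.2 (D.nabla' u.2 v.1))) fun t => ?_
  simp only [leftDeriv_apply]
  apply N_ext <;>
  · simp only [mkN_fst, mkN_snd, add_fst, add_snd, smul_fst, zero_snd, map_zero, zero_add, smul_snd,
      map_smul, LinearMap.smul_apply, LinearMap.zero_apply]
    module

theorem lieBracket_leftDeriv (u v : D.N) :
    VectorField.lieBracket ℝ (fun p => D.leftDeriv p u) (fun p => D.leftDeriv p v) 0
      = D.mkN (D.nabla' v.1 u.2 - D.nabla' u.1 v.2) (D.nabla u.1 v.2 - D.nabla v.1 u.2) := by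
  have h0 : ∀ w : D.N, D.leftDeriv 0 w = w := fun w => by
    rw [leftDeriv_apply]
    apply N_ext <;> simp [mkN_fst, mkN_snd, zero_snd]
  rw [VectorField.lieBracket, h0, h0, fderiv_leftDeriv_zero_apply, fderiv_leftDeriv_zero_apply]
  apply N_ext
  · rfl
  · simp only [sub_snd, mkN_snd]
    rw [D.affine.torsion_free u.2, D.affine.torsion_free v.2]
    abel

theorem bracket_apply (u v : GroupLieAlgebra 𝓘(ℝ, D.N) D.N) :
    ⁅u, v⁆ = D.mkN (D.nabla' v.1 u.2 - D.nabla' u.1 v.2) (D.nabla u.1 v.2 - D.nabla v.1 u.2) := by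
  have h : ∀ w : D.N, (mulInvariantVectorField (I := 𝓘(ℝ, D.N)) (G := D.N) w : D.N → D.N)
      = fun p => D.leftDeriv p w :=
    fun w => funext fun p => D.mulInvariantVectorField_eq w p
  rw [GroupLieAlgebra.bracket_def, ← VectorField.mlieBracketWithin_univ]
  refine (congrFun VectorField.mlieBracketWithin_eq_lieBracketWithin _).trans ?_
  refine (congrArg₂ (fun X Y : D.N → D.N => VectorField.lieBracketWithin ℝ X Y Set.univ (0 : D.N))
    (h u) (h v)).trans ?_
  rw [VectorField.lieBracketWithin_univ]
  exact D.lieBracket_leftDeriv u v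

variable {D}

/-- Brackets of length three are governed by `D.cubic`. -/
theorem lie_lie (u v w : GroupLieAlgebra 𝓘(ℝ, D.N) D.N) :
    ⁅u, ⁅v, w⁆⁆ = D.mkN (D.cubic u.1 v.1 w.2 - D.cubic u.1 w.1 v.2)
      (D.cubic u.2 v.1 w.2 - D.cubic u.2 w.1 v.2) := by
  rw [D.bracket_apply u, D.bracket_apply v]
  apply N_ext
  · simp only [mkN_fst, mkN_snd, map_sub, LinearMap.sub_apply, nabla'_nabla'_left, nabla'_nabla_eq]
    abel
  · simp only [mkN_fst, mkN_snd, map_sub, LinearMap.sub_apply, nabla_nabla, nabla_nabla'_left_eq]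
    abel

theorem lie_lie_lie (u v w z : GroupLieAlgebra 𝓘(ℝ, D.N) D.N) : ⁅u, ⁅v, ⁅w, z⁆⁆⁆ = 0 := by
  rw [D.bracket_apply u, lie_lie]
  apply N_ext <;>
  simp only [mkN_fst, mkN_snd, map_sub, LinearMap.sub_apply, nabla'_cubic, nabla'_cubic_left,
    nabla_cubic, nabla_cubic_left, sub_zero] <;> rfl

theorem nilpotencyLength_eq_three {x y z : V} (h : D.cubic x y z ≠ 0) :
    LieModule.nilpotencyLength (GroupLieAlgebra 𝓘(ℝ, D.N) D.N)
      (GroupLieAlgebra 𝓘(ℝ, D.N) D.N) = 3 := by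
  rw [LieModule.nilpotencyLength_eq_succ_iff ℝ, lowerCentralSeries_eq_bot_iff,
    Ne, lowerCentralSeries_eq_bot_iff]
  refine ⟨eq_top_iff.2 fun u _ v w r => lie_lie_lie r w v u, fun h' => h ?_⟩
  -- up to sign, `cubic x y z` is the first component of the bracket of `(x, 0)`, `(y, 0)`, `(0, z)`
  have h1 : ∀ u v w : GroupLieAlgebra 𝓘(ℝ, D.N) D.N, ⁅u, ⁅v, w⁆⁆ = 0 := fun u v w =>
    (eq_top_iff.1 h' (LieSubmodule.mem_top w) : _) v u
  have h2 := congrArg Prod.fst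
    ((lie_lie (D.mkN x 0) (D.mkN y 0) (D.mkN 0 z)).symm.trans (h1 _ _ _))
  change _ = (0 : V) at h2
  simpa [mkN_fst, mkN_snd, cubic] using h2

theorem nilpotencyLength_eq_two (h : ∀ x y z, D.cubic x y z = 0) {x y : V}
    (hxy : D.nabla x y ≠ 0) : LieModule.nilpotencyLength (GroupLieAlgebra 𝓘(ℝ, D.N) D.N)
      (GroupLieAlgebra 𝓘(ℝ, D.N) D.N) = 2 := by
  rw [LieModule.nilpotencyLength_eq_succ_iff ℝ, lowerCentralSeries_eq_bot_iff,
    Ne, lowerCentralSeries_eq_bot_iff]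
  refine ⟨eq_top_iff.2 fun u _ v w => ?_, fun h' => hxy ?_⟩
  · refine (lie_lie w v u).trans ?_
    rw [h, h, h, h, sub_zero]
    rfl
  · have h1 : ∀ u v : GroupLieAlgebra 𝓘(ℝ, D.N) D.N, ⁅u, v⁆ = 0 := fun u v =>
      (eq_top_iff.1 h' (LieSubmodule.mem_top v) : _) u
    have h2 := congrArg Prod.snd
      ((D.bracket_apply (D.mkN x 0) (D.mkN 0 y)).symm.trans (h1 _ _))
    change _ = (0 : V) at h2
    simpa [mkN_fst, mkN_snd] using h2

end LieBracket

section Nilpotent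
open scoped commutatorElement
variable {V : Type*} [AddCommGroup V] [Module ℝ V] (D : AffineSymplecticPair V)

theorem commutator_fst (p q : D.N) : ⁅p, q⁆.1 =
    D.nabla' q.1 p.2 - D.nabla' p.1 q.2 + (1 / 2 : ℝ) • D.cubic p.1 p.1 q.2
      - (1 / 2 : ℝ) • D.cubic q.1 q.1 p.2 + D.cubic p.1 q.1 q.2 - D.cubic p.1 q.1 p.2 := by
  simp only [commutatorElement_def, mul_fst, mul_snd, inv_fst, inv_snd, alpha, beta, map_add,
    map_sub, map_smul, smul_add, smul_sub, LinearMap.add_apply, LinearMap.sub_apply,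
    LinearMap.smul_apply, nabla_nabla, nabla'_nabla', nabla_nabla'_eq, nabla_nabla'_left_eq,
    nabla'_nabla_eq, nabla'_nabla_left_eq, nabla_nabla_left, nabla'_nabla'_left, nabla_cubic,
    nabla_cubic_left, nabla'_cubic, nabla'_cubic_left, cubic_nabla_left, cubic_nabla'_left,
    cubic_cubic_left, map_zero, neg_zero, map_neg, smul_zero, LinearMap.neg_apply]
  simp only [D.cubic_swap_left, D.cubic_swap_right]
  module

theorem commutator_snd (p q : D.N) : ⁅p, q⁆.2 =
    D.nabla p.1 q.2 - D.nabla q.1 p.2 + (1 / 2 : ℝ) • D.cubic p.1 q.2 q.2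
      - (1 / 2 : ℝ) • D.cubic q.1 p.2 p.2 := by
  simp only [commutatorElement_def, mul_snd, inv_fst, inv_snd, alpha, beta, map_add, map_sub,
    map_smul, smul_add, smul_sub, LinearMap.add_apply, LinearMap.sub_apply, LinearMap.smul_apply,
    nabla'_nabla', nabla_nabla'_eq, nabla'_nabla_eq, nabla'_nabla_left_eq, nabla_nabla_left,
    nabla_cubic, nabla_cubic_left, nabla'_cubic, nabla'_cubic_left, cubic_nabla_left,
    cubic_cubic_left, map_zero, neg_zero, map_neg, smul_zero, LinearMap.neg_apply,
    LinearMap.zero_apply]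
  simp only [D.affine.torsion_free, D.cubic_swap_left, D.cubic_swap_right]
  module

/-- The components of a commutator are sums of images of `∇` and `∇'`, so `D.cubic` annihilates
them. -/
theorem cubic_commutator_fst (p q : D.N) (y z : V) : D.cubic ⁅p, q⁆.1 y z = 0 := by
  simp only [commutator_fst, cubic, map_add, map_sub, map_smul, LinearMap.add_apply,
    LinearMap.sub_apply, LinearMap.smul_apply, nabla_nabla'_nabla', nabla_nabla_left, smul_zero,
    add_zero, sub_zero]

theorem cubic_commutator_snd (p q : D.N) (y z : V) : D.cubic ⁅p, q⁆.2 y z = 0 := by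
  simp only [commutator_snd, cubic, map_add, map_sub, map_smul, LinearMap.add_apply,
    LinearMap.sub_apply, LinearMap.smul_apply, nabla_nabla_left, smul_zero, add_zero, sub_zero]

theorem commutator_commutator_fst (p q r : D.N) :
    ⁅⁅p, q⁆, r⁆.1 = D.cubic q.1 r.1 p.2 - D.cubic p.1 r.1 q.2 := by
  have h1 : ∀ y z, D.cubic y ⁅p, q⁆.2 z = 0 := fun y z => by
    rw [D.cubic_swap_left, cubic_commutator_snd]
  have h2 : ∀ x y, D.cubic x y ⁅p, q⁆.2 = 0 := fun x y => by rw [D.cubic_swap_right, h1]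
  rw [commutator_fst]
  simp only [cubic_commutator_fst, h2]
  simp only [commutator_fst, commutator_snd, map_add, map_sub, map_smul, LinearMap.add_apply,
    LinearMap.sub_apply, LinearMap.smul_apply, nabla'_nabla'_left, nabla'_cubic_left, nabla'_cubic,
    nabla'_nabla_eq]
  simp only [D.cubic_swap_left r.1]
  module

theorem commutator_commutator_snd (p q r : D.N) :
    ⁅⁅p, q⁆, r⁆.2 = D.cubic r.2 q.1 p.2 - D.cubic r.2 p.1 q.2 := by
  have h1 : ∀ y z, D.cubic y ⁅p, q⁆.2 z = 0 := fun y z => by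
    rw [D.cubic_swap_left, cubic_commutator_snd]
  rw [commutator_snd]
  simp only [cubic_commutator_fst, h1]
  simp only [commutator_fst, commutator_snd, map_add, map_sub, map_smul, LinearMap.add_apply,
    LinearMap.sub_apply, LinearMap.smul_apply, nabla_nabla, nabla_cubic_left, nabla_cubic,
    nabla_nabla'_left_eq]
  module

/-- Commutators of length four are trivial, because those of length three are made of values of
`D.cubic`, which are annihilated by `∇` and `∇'`. -/
theorem commutator_commutator_commutator (p q r s : D.N) : ⁅⁅⁅p, q⁆, r⁆, s⁆ = 1 := by
  have hc1 : ∀ x y, D.cubic ⁅⁅p, q⁆, r⁆.1 x y = 0 := cubic_commutator_fst D _ _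
  have hc2 : ∀ x y, D.cubic x ⁅⁅p, q⁆, r⁆.2 y = 0 := fun y z => by
    rw [D.cubic_swap_left, cubic_commutator_snd]
  apply N_ext
  · rw [commutator_fst]
    simp only [hc1, hc2, D.cubic_swap_right s.1 s.1]
    simp only [commutator_commutator_fst, commutator_commutator_snd, map_sub, LinearMap.sub_apply,
      nabla'_cubic, nabla'_cubic_left, smul_zero, sub_zero, add_zero, one_fst]
  · rw [commutator_snd]
    simp only [hc1, hc2]
    simp only [commutator_commutator_fst, commutator_commutator_snd, map_sub, LinearMap.sub_apply,
      nabla_cubic, nabla_cubic_left, smul_zero, sub_zero, add_zero, one_snd]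

theorem upperCentralSeries_three : Subgroup.upperCentralSeries D.N 3 = ⊤ :=
  eq_top_iff.2 fun p _ q r s => D.commutator_commutator_commutator p q r s

instance : Group.IsNilpotent D.N := ⟨3, D.upperCentralSeries_three⟩

theorem nilpotencyClass_eq_three {x y z : V} (h : D.cubic x y z ≠ 0) :
    Group.nilpotencyClass D.N = 3 := by
  refine le_antisymm (Subgroup.upperCentralSeries_eq_top_iff_nilpotencyClass_le.1
    D.upperCentralSeries_three) (Nat.lt_of_not_le fun h' => h ?_)
  rw [← Subgroup.upperCentralSeries_eq_top_iff_nilpotencyClass_le] at h'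
  -- the iterated commutator of `(0, z)`, `(x, 0)`, `(y, 0)` has the first component `cubic x y z`
  have h2 : D.mkN 0 z ∈ Subgroup.upperCentralSeries D.N 2 := h' ▸ Subgroup.mem_top _
  have h3 : ⁅⁅D.mkN 0 z, D.mkN x 0⁆, D.mkN y 0⁆ = 1 :=
    h2 _ _
  have h4 := congrArg Prod.fst h3
  rw [commutator_commutator_fst] at h4
  simpa [mkN_fst, mkN_snd, cubic, one_fst] using h4

theorem nilpotencyClass_eq_two (h : ∀ x y z, D.cubic x y z = 0) {x y : V}
    (hxy : D.nabla x y ≠ 0) : Group.nilpotencyClass D.N = 2 := by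
  refine le_antisymm (Subgroup.upperCentralSeries_eq_top_iff_nilpotencyClass_le.1
    (eq_top_iff.2 fun p _ q r => ?_)) (Nat.lt_of_not_le fun h' => hxy ?_)
  · apply N_ext
    · rw [commutator_commutator_fst, h, h, sub_zero, one_fst]
    · rw [commutator_commutator_snd, h, h, sub_zero, one_snd]
  · rw [← Subgroup.upperCentralSeries_eq_top_iff_nilpotencyClass_le] at h'
    have h2 : D.mkN x 0 ∈ Subgroup.upperCentralSeries D.N 1 :=
      h' ▸ Subgroup.mem_top _
    have h3 : ⁅D.mkN x 0, D.mkN 0 y⁆ = 1 := h2 _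
    have h4 := congrArg Prod.snd h3
    rw [commutator_snd] at h4
    simpa [mkN_fst, mkN_snd, h, one_snd] using h4

end Nilpotent
end AffineSymplecticPair

/-! ### The three-parameter family in coordinates -/

theorem alpha_pair₄ (a b c : ℝ) (x' y : Fin 4 → ℝ) :
    (pair₄ a b c).alpha x' y = alpha₄ a b c x' y := by
  ext i
  simp only [AffineSymplecticPair.alpha, pair₄, nabla₄_apply, nabla₄'_apply, alpha₄]
  fin_cases i <;> simp [Matrix.vecHead, Matrix.vecTail] <;> ring

theorem beta_pair₄ (a b c : ℝ) (x' y : Fin 4 → ℝ) :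
    (pair₄ a b c).beta x' y = beta₄ b c x' y := by
  ext i
  simp only [AffineSymplecticPair.beta, pair₄, nabla₄_apply, nabla₄'_apply, beta₄]
  fin_cases i <;> simp [Matrix.vecHead, Matrix.vecTail] <;> ring

theorem maurerCartan_pair₄ (a b c : ℝ) (p u : N₄ a b c) :
    (pair₄ a b c).maurerCartan p u
      = ((coframeE a b c p.2 u.1, coframeF b c p.2 u.1 u.2) : R8) := by
  rw [AffineSymplecticPair.maurerCartan_apply]
  obtain ⟨u, u'⟩ := u
  obtain ⟨p, p'⟩ := p
  simp only [AffineSymplecticPair.mkN, pair₄, nabla₄_apply, nabla₄'_apply, coframeE, coframeF]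
  refine Prod.ext ?_ ?_ <;> ext i <;> fin_cases i <;>
    simp [Matrix.vecHead, Matrix.vecTail] <;> ring

theorem cubic_pair₄ (a b c : ℝ) (x y z : Fin 4 → ℝ) :
    (pair₄ a b c).cubic x y z = ((c - b) * ((x 0 + x 2) * (y 0 + y 2) * (z 0 + z 2))) •
      ![0, 1, 0, 1] := by
  ext i
  simp only [AffineSymplecticPair.cubic, pair₄, nabla₄_apply, nabla₄'_apply]
  fin_cases i <;> simp <;> ring

theorem cubic_pair₄_eq_zero_iff (a b c : ℝ) :
    (∀ x y z, (pair₄ a b c).cubic x y z = 0) ↔ b = c := by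
  refine ⟨fun h => ?_, fun h x y z => by rw [cubic_pair₄, h, sub_self, zero_mul, zero_smul]⟩
  have := congrFun (h (Pi.single 0 1) (Pi.single 0 1) (Pi.single 0 1)) 1
  rw [cubic_pair₄] at this
  simp at this
  linarith

theorem nabla₄_ne_zero : nabla₄ (Pi.single 0 1) (Pi.single 0 1) ≠ 0 := by
  intro h
  simpa [nabla₄_apply] using congrFun h 0

theorem explicitMetricAt_eq (p u v : R8) :
    -omega₄ (coframeE 0 1 0 p.2 u.1) (coframeF 1 0 p.2 v.1 v.2)
      + omega₄ (coframeF 1 0 p.2 u.1 u.2) (coframeE 0 1 0 p.2 v.1) = explicitMetricAt p u v := by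
  simp [omega₄_apply, coframeE, coframeF, explicitMetricAt, symProd, dX, dX']
  ring

theorem metric_pair₄ (p u v : N₄ 0 1 0) :
    (pair₄ 0 1 0).metric p u v = explicitMetricAt p u v := by
  have h : (pair₄ 0 1 0).metric p u v = (pair₄ 0 1 0).metricOne
    ((pair₄ 0 1 0).maurerCartan p u) ((pair₄ 0 1 0).maurerCartan p v) := rfl
  rw [h, maurerCartan_pair₄, maurerCartan_pair₄]
  exact explicitMetricAt_eq p u v

/-! ### Lattices -/

namespace AffineSymplecticPair

/-- The subgroup `L × L'` of `N_{∇,∇'}`, for additive subgroups `L` and `L'` of `V` which are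
preserved by the group law. -/
def subgroupProd {V : Type*} [AddCommGroup V] [Module ℝ V] (D : AffineSymplecticPair V)
    (L L' : AddSubgroup V) (h : ∀ x' ∈ L', ∀ y ∈ L, D.alpha x' y ∈ L)
    (h' : ∀ x' ∈ L', ∀ y ∈ L, D.beta x' y ∈ L') : Subgroup D.N where
  carrier := {p | p.1 ∈ L ∧ p.2 ∈ L'}
  mul_mem' hp hq := ⟨L.add_mem hp.1 (h _ hp.2 _ hq.1), L'.add_mem (h' _ hp.2 _ hq.1) hq.2⟩
  one_mem' := ⟨L.zero_mem, L'.zero_mem⟩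
  inv_mem' hp := ⟨h _ (L'.neg_mem hp.2) _ (L.neg_mem hp.1),
    h' _ (L'.neg_mem hp.2) _ (L.neg_mem hp.1)⟩

end AffineSymplecticPair

/-- The lattice `r ℤ⁴` in `ℝ⁴`. -/
def scaledIntegers (r : ℝ) : AddSubgroup (Fin 4 → ℝ) where
  carrier := {x | ∃ m : Fin 4 → ℤ, x = fun i => r * m i}
  add_mem' := by
    rintro _ _ ⟨m, rfl⟩ ⟨n, rfl⟩
    exact ⟨m + n, by ext i; simp [mul_add]⟩
  zero_mem' := ⟨0, by ext i; simp⟩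
  neg_mem' := by
    rintro _ ⟨m, rfl⟩
    exact ⟨-m, by ext i; simp⟩

theorem alpha₄_mem {d A B C : ℤ} {a b c : ℝ} (ha : d * a = A) (hb : d * b = B) (hc : d * c = C)
    {x' y : Fin 4 → ℝ} (hx : x' ∈ scaledIntegers (2 * d)) (hy : y ∈ scaledIntegers 1) :
    alpha₄ a b c x' y ∈ scaledIntegers 1 := by
  obtain ⟨m, rfl⟩ := hx
  obtain ⟨n, rfl⟩ := hy
  refine ⟨![n 0 + 2 * A * (n 0 + n 2) * (m 0 + m 2),
    n 1 + 2 * (B * n 0 - A * n 1 + C * n 2 + A * n 3) * m 0 - 2 * A * (n 0 + n 2) * m 1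
      + 2 * (C * n 0 - A * n 1 + (-B + 2 * C) * n 2 + A * n 3) * m 2
      + 2 * A * (n 0 + n 2) * m 3 + (-B + C) * (n 0 + n 2) ^ 2 * (m 0 + m 2),
    n 2 - 2 * A * (n 0 + n 2) * (m 0 + m 2),
    n 3 + 2 * (C * n 0 - A * n 1 + (-B + 2 * C) * n 2 + A * n 3) * m 0
      - 2 * A * (n 0 + n 2) * m 1
      + 2 * ((-B + 2 * C) * n 0 - A * n 1 + (-2 * B + 3 * C) * n 2 + A * n 3) * m 2
      + 2 * A * (n 0 + n 2) * m 3 + (-B + C) * (n 0 + n 2) ^ 2 * (m 0 + m 2)], ?_⟩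
  ext i
  fin_cases i <;> simp [alpha₄, ← ha, ← hb, ← hc] <;> ring

theorem beta₄_mem {d B C : ℤ} {b c : ℝ} (hb : d * b = B) (hc : d * c = C)
    {x' y : Fin 4 → ℝ} (hx : x' ∈ scaledIntegers (2 * d)) (hy : y ∈ scaledIntegers 1) :
    beta₄ b c x' y ∈ scaledIntegers (2 * d) := by
  obtain ⟨m, rfl⟩ := hx
  obtain ⟨n, rfl⟩ := hy
  refine ⟨![m 0 - (m 0 + m 2) * (n 0 + n 2),
    m 1 + (m 1 - m 3) * (n 0 + n 2) + (m 0 + m 2) * (n 1 - n 3)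
      - (-B + C) * (m 0 + m 2) ^ 2 * (n 0 + n 2),
    m 2 + (m 0 + m 2) * (n 0 + n 2),
    m 3 + (m 1 - m 3) * (n 0 + n 2) + (m 0 + m 2) * (n 1 - n 3)
      - (-B + C) * (m 0 + m 2) ^ 2 * (n 0 + n 2)], ?_⟩
  ext i
  fin_cases i <;> simp [beta₄, ← hb, ← hc] <;> ring

theorem exists_int_add_mem_Ico (r : ℝ) : ∃ n : ℤ, 0 ≤ r + n ∧ r + n < 1 :=
  ⟨-⌊r⌋, by push_cast; linarith [Int.floor_le r], by push_cast; linarith [Int.lt_floor_add_one r]⟩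

/-- The components `x₁ + x₃`, `x₁`, `x₂ - x₄`, `x₄` of a point are moved, in this order, to the
unit interval; each step does not affect the components treated before it. -/
theorem exists_norm_add_alpha₄_le (a b c : ℝ) (x x' : Fin 4 → ℝ) :
    ∃ y ∈ scaledIntegers 1, ‖x + alpha₄ a b c x' y‖ ≤ 2 := by
  obtain ⟨t, ht0, ht1⟩ := exists_int_add_mem_Ico (x 0 + x 2)
  obtain ⟨n, hn0, hn1⟩ := exists_int_add_mem_Ico (x 0 + a * t * (x' 0 + x' 2))
  obtain ⟨w, hw0, hw1⟩ := exists_int_add_mem_Ico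
    (x 1 - x 3 + ((b * n + c * (t - n)) * x' 0 + (c * n + (-b + 2 * c) * (t - n)) * x' 2)
      - ((c * n + (-b + 2 * c) * (t - n)) * x' 0
        + ((-b + 2 * c) * n + (-2 * b + 3 * c) * (t - n)) * x' 2))
  obtain ⟨k, hk0, hk1⟩ := exists_int_add_mem_Ico
    (x 3 + (c * n + (-b + 2 * c) * (t - n) - a * w) * x' 0 - a * t * x' 1
      + ((-b + 2 * c) * n + (-2 * b + 3 * c) * (t - n) - a * w) * x' 2
      + a * t * x' 3 + 1 / 2 * (-b + c) * t ^ 2 * (x' 0 + x' 2))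
  refine ⟨fun i => 1 * ((![n, w + k, t - n, k] : Fin 4 → ℤ) i : ℝ), ⟨_, rfl⟩, ?_⟩
  rw [pi_norm_le_iff_of_nonneg (by norm_num)]
  intro i
  rw [Real.norm_eq_abs, abs_le]
  fin_cases i <;> simp [alpha₄] <;> constructor <;> ring_nf at * <;> linarith

theorem exists_norm_add_le (d : ℤ) (hd : 0 < d) (x : Fin 4 → ℝ) :
    ∃ y ∈ scaledIntegers (2 * d), ‖x + y‖ ≤ 2 * d := by
  have hd' : (0 : ℝ) < d := by exact_mod_cast hd
  choose n h0 h1 using fun i => exists_int_add_mem_Ico (x i / (2 * d))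
  refine ⟨_, ⟨n, rfl⟩, ?_⟩
  rw [pi_norm_le_iff_of_nonneg (by positivity)]
  intro i
  have h : (x + fun i => 2 * (d : ℝ) * n i) i = 2 * d * (x i / (2 * d) + n i) := by
    simp only [Pi.add_apply]
    field_simp
  rw [h, Real.norm_eq_abs, abs_of_nonneg (mul_nonneg (by positivity) (h0 i))]
  nlinarith [h1 i]

theorem exists_common_denominator {a b c : ℝ} (ha : a ∈ Set.range ((↑) : ℚ → ℝ))
    (hb : b ∈ Set.range ((↑) : ℚ → ℝ)) (hc : c ∈ Set.range ((↑) : ℚ → ℝ)) :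
    ∃ d A B C : ℤ, 0 < d ∧ d * a = A ∧ d * b = B ∧ d * c = C := by
  obtain ⟨a, rfl⟩ := ha
  obtain ⟨b, rfl⟩ := hb
  obtain ⟨c, rfl⟩ := hc
  have h : ∀ q : ℚ, (q.den : ℝ) * q = q.num := fun q => by
    exact_mod_cast Rat.den_mul_eq_num q
  refine ⟨a.den * b.den * c.den, a.num * b.den * c.den, b.num * a.den * c.den,
    c.num * a.den * b.den, by positivity, ?_, ?_, ?_⟩ <;> push_cast
  · rw [← h a]; ring
  · rw [← h b]; ring
  · rw [← h c]; ring

/-- All coordinates of a point of the lattice are integers, so the open unit ball contains no point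
of it except `0`, which is the identity of the group. -/
theorem discreteTopology_of_subset_lattice {a b c : ℝ} {Γ : Subgroup (N₄ a b c)} {d : ℤ}
    (hΓ : ∀ p ∈ Γ, p.1 ∈ scaledIntegers 1 ∧ p.2 ∈ scaledIntegers (2 * d)) :
    DiscreteTopology Γ := by
  have hint : ∀ k : ℤ, ‖(k : ℝ)‖ < 1 → k = 0 := fun k hk => by
    rw [Real.norm_eq_abs] at hk
    exact Int.abs_lt_one_iff.1 (by exact_mod_cast hk)
  refine discreteTopology_of_isOpen_singleton_one (Metric.isOpen_singleton_iff.2 ⟨1, one_pos, ?_⟩)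
  rintro ⟨p, hp⟩ hdist
  have hnorm : ‖p‖ < 1 := by
    rw [← dist_zero_right]
    exact hdist
  obtain ⟨⟨m, hm⟩, n, hn⟩ := hΓ p hp
  have h1 : ∀ i, ‖p.1 i‖ < 1 := fun i =>
    ((norm_le_pi_norm p.1 i).trans (le_max_left _ _)).trans_lt hnorm
  have h2 : ∀ i, ‖p.2 i‖ < 1 := fun i =>
    ((norm_le_pi_norm p.2 i).trans (le_max_right _ _)).trans_lt hnorm
  apply Subtype.ext
  apply AffineSymplecticPair.N_ext
  · ext i
    have := hint (m i) (by simpa [hm] using h1 i)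
    simp [hm, this, AffineSymplecticPair.one_fst]
  · ext i
    have := hint (2 * d * n i) (by simpa [hn] using h2 i)
    have h : (2 * (d : ℝ) * n i) = 0 := by exact_mod_cast this
    simp [hn, h, AffineSymplecticPair.one_snd]

/-- For a common denominator `d` of `a`, `b` and `c`, the subgroup is `ℤ⁴ × (2d ℤ)⁴`; the factor `2`
compensates the coefficient `1 / 2` in the group law. -/
theorem exists_discrete_cocompact {a b c : ℝ} (ha : a ∈ Set.range ((↑) : ℚ → ℝ))
    (hb : b ∈ Set.range ((↑) : ℚ → ℝ)) (hc : c ∈ Set.range ((↑) : ℚ → ℝ)) :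
    ∃ Γ : Subgroup (N₄ a b c), DiscreteTopology Γ ∧ CompactSpace (N₄ a b c ⧸ Γ) := by
  obtain ⟨d, A, B, C, hd, hA, hB, hC⟩ := exists_common_denominator ha hb hc
  let Γ := (pair₄ a b c).subgroupProd (scaledIntegers 1) (scaledIntegers (2 * d))
    (fun x' hx y hy => alpha_pair₄ a b c x' y ▸ alpha₄_mem hA hB hC hx hy)
    (fun x' hx y hy => beta_pair₄ a b c x' y ▸ beta₄_mem hB hC hx hy)
  refine ⟨Γ, discreteTopology_of_subset_lattice fun p hp => hp, ⟨?_⟩⟩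
  have hK : IsCompact (Metric.closedBall (0 : N₄ a b c) (max 2 (2 * d))) :=
    isCompact_closedBall _ _
  refine (hK.image (QuotientGroup.continuous_mk (N := Γ))).of_isClosed_subset isClosed_univ ?_
  rintro x -
  obtain ⟨p, rfl⟩ := QuotientGroup.mk_surjective x
  obtain ⟨y, hy, hy2⟩ := exists_norm_add_alpha₄_le a b c p.1 p.2
  obtain ⟨y', hy', hy2'⟩ := exists_norm_add_le d hd ((pair₄ a b c).beta p.2 y)
  -- right translation by `(y, y')` moves the first component by `y`, then the second one by `y'`
  refine ⟨p * (pair₄ a b c).mkN y y', ?_, (QuotientGroup.eq.2 ?_).symm⟩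
  · rw [mem_closedBall_zero_iff]
    refine max_le_max ?_ hy2'
    rw [AffineSymplecticPair.mul_fst, AffineSymplecticPair.mkN_fst, alpha_pair₄]
    exact hy2
  · rw [inv_mul_cancel_left]
    exact ⟨hy, hy'⟩

/-! ### Left translations and the explicit metric -/

namespace AffineSymplecticPair
variable {V : Type*} [NormedAddCommGroup V] [NormedSpace ℝ V] [FiniteDimensional ℝ V]
variable (D : AffineSymplecticPair V)

/-- The fields `g`, `J` and `E` are invariant under left translations. -/
theorem isInducedThrough_mul_left (p : D.N) :
    IsInducedThrough (fun q : D.N => p * q) D.metric D.J D.E D.metric D.J D.E := by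
  have h : ∀ q u : D.N, (mfderiv 𝓘(ℝ, D.N) 𝓘(ℝ, D.N) (fun r : D.N => p * r) q : D.N →L[ℝ] D.N) u
      = D.leftDeriv (p * q) (D.maurerCartan q u) := fun q u => by
    rw [mfderiv_eq_fderiv]
    exact D.fderiv_mul_left p q u
  have hform : ∀ q u v : D.N, coframeForm D.maurerCartan D.metricN (p * q)
      (D.leftDeriv (p * q) (D.maurerCartan q u)) (D.leftDeriv (p * q) (D.maurerCartan q v))
      = coframeForm D.maurerCartan D.metricN q u v := fun q u v => by
    simp only [coframeForm_apply, maurerCartan_leftDeriv]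
  have hendo : ∀ (A : D.N →L[ℝ] D.N) (q u : D.N), coframeEndo D.maurerCartan D.leftDeriv A (p * q)
      (D.leftDeriv (p * q) (D.maurerCartan q u)) = D.leftDeriv (p * q)
        (D.maurerCartan q (coframeEndo D.maurerCartan D.leftDeriv A q u)) := fun A q u => by
    simp only [coframeEndo_apply, maurerCartan_leftDeriv]
  refine ⟨fun q u v => ?_, fun q u => ?_, fun q u => ?_⟩
  · exact (congrArg₂ (fun u v : D.N => D.metric (p * q) u v) (h q u) (h q v)).trans (hform q u v)
  · exact (congrArg (fun u : D.N => D.J (p * q) u) (h q u)).trans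
      ((hendo D.JN q u).trans (h q _).symm)
  · exact (congrArg (fun u : D.N => D.E (p * q) u) (h q u)).trans
      ((hendo D.EN q u).trans (h q _).symm)

end AffineSymplecticPair

/-- `ℝ⁸` and the manifold underlying the group are the same by definition, which is what makes this
equation meaningful. -/
theorem explicitMetric_eq_metric :
    explicitMetric = ((pair₄ 0 1 0).metric : BilinField (N₄ 0 1 0) (N₄ 0 1 0)) := by
  funext p
  exact (ContinuousLinearMap.ext fun u => ContinuousLinearMap.ext fun v =>
    (metric_pair₄ p u v).symm : explicitMetricAt p = (pair₄ 0 1 0).metric p)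

end

theorem mainTheorem6 :
    (∀ a b c : ℝ,
      -- the affine-symplectic data
      (IsSymplecticForm omega₄ ∧ IsAffineStructure nabla₄ ∧ IsAffineStructure (nabla₄' a b c) ∧
        IsCompatibleWith nabla₄ omega₄ ∧ IsCompatibleWith (nabla₄' a b c) omega₄ ∧
        AreCompatible nabla₄ (nabla₄' a b c)) ∧
      -- the Lie group, its group law in coordinates and its left-invariant coframe
      LieGroup 𝓘(ℝ, N₄ a b c) ∞ (N₄ a b c) ∧
      (∀ p q : N₄ a b c,
        p * q = ((p.1 + alpha₄ a b c p.2 q.1, beta₄ b c p.2 q.1 + q.2) : R8)) ∧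
      (∀ p u : N₄ a b c, (pair₄ a b c).maurerCartan p u
        = ((coframeE a b c p.2 u.1, coframeF b c p.2 u.1 u.2) : R8)) ∧
      -- the Lie bracket
      (∀ u v : GroupLieAlgebra 𝓘(ℝ, N₄ a b c) (N₄ a b c),
        ⁅u, v⁆ = ((nabla₄' a b c v.1 u.2 - nabla₄' a b c u.1 v.2,
          nabla₄ u.1 v.2 - nabla₄ v.1 u.2) : R8)) ∧
      -- the nilpotency class of the group and of its Lie algebra
      (b ≠ c → Group.nilpotencyClass (N₄ a b c) = 3 ∧
        LieModule.nilpotencyLength (GroupLieAlgebra 𝓘(ℝ, N₄ a b c) (N₄ a b c))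
          (GroupLieAlgebra 𝓘(ℝ, N₄ a b c) (N₄ a b c)) = 3) ∧
      (b = c → Group.nilpotencyClass (N₄ a b c) = 2 ∧
        LieModule.nilpotencyLength (GroupLieAlgebra 𝓘(ℝ, N₄ a b c) (N₄ a b c))
          (GroupLieAlgebra 𝓘(ℝ, N₄ a b c) (N₄ a b c)) = 2) ∧
      -- the invariant hypersymplectic structure
      IsHypersymplectic (pair₄ a b c).metric (pair₄ a b c).J (pair₄ a b c).E ∧
      (∀ p : N₄ a b c, IsInducedThrough (fun q : N₄ a b c => p * q)
        (pair₄ a b c).metric (pair₄ a b c).J (pair₄ a b c).E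
        (pair₄ a b c).metric (pair₄ a b c).J (pair₄ a b c).E) ∧
      IsNeutralKahler (pair₄ a b c).metric (pair₄ a b c).J ∧
      (pair₄ a b c).metric.IsRicciFlat ∧
      (pair₄ a b c).metric.IsComplete ∧
      ((pair₄ a b c).metric.IsFlat ↔ b = c) ∧
      -- discrete co-compact subgroups, and the geometry of the compact quotients
      (a ∈ Set.range ((↑) : ℚ → ℝ) → b ∈ Set.range ((↑) : ℚ → ℝ) →
        c ∈ Set.range ((↑) : ℚ → ℝ) →
        ∃ Γ : Subgroup (N₄ a b c), DiscreteTopology Γ ∧ CompactSpace (N₄ a b c ⧸ Γ)) ∧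
      (∀ Γ : Subgroup (N₄ a b c), DiscreteTopology Γ → CompactSpace (N₄ a b c ⧸ Γ) →
        CompactSpace (MulAction.orbitRel.Quotient Γ (N₄ a b c)) ∧
        T2Space (MulAction.orbitRel.Quotient Γ (N₄ a b c)) ∧
        ∃ (_ : ChartedSpace (N₄ a b c) (MulAction.orbitRel.Quotient Γ (N₄ a b c)))
          (g : BilinField (N₄ a b c) (MulAction.orbitRel.Quotient Γ (N₄ a b c)))
          (J E : EndoField (N₄ a b c) (MulAction.orbitRel.Quotient Γ (N₄ a b c))),
          IsManifold 𝓘(ℝ, N₄ a b c) ∞ (MulAction.orbitRel.Quotient Γ (N₄ a b c)) ∧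
          IsLocalDiffeomorph 𝓘(ℝ, N₄ a b c) 𝓘(ℝ, N₄ a b c) ∞
            (Quotient.mk (MulAction.orbitRel Γ (N₄ a b c))) ∧
          IsInducedThrough (Quotient.mk (MulAction.orbitRel Γ (N₄ a b c)))
            (pair₄ a b c).metric (pair₄ a b c).J (pair₄ a b c).E g J E ∧
          IsHypersymplectic g J E ∧ IsNeutralKahler g J ∧ g.IsRicciFlat ∧ g.IsComplete ∧
          (g.IsFlat ↔ b = c))) ∧
    -- the explicit metric on `ℝ⁸`
    (∀ p u v : R8, (pair₄ 0 1 0).metric p u v = explicitMetric p u v) ∧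
    (∃ J : EndoField R8 R8, IsNeutralKahler explicitMetric J) ∧
    explicitMetric.IsRicciFlat ∧ explicitMetric.IsComplete ∧ ¬ explicitMetric.IsFlat := by
  have hN : ∀ a b c : ℝ, (pair₄ a b c).IsLocalModel (id : N₄ a b c → N₄ a b c) := fun a b c =>
    (pair₄ a b c).isLocalModel_id
  refine ⟨fun a b c => ⟨⟨isSymplecticForm_omega₄, isAffineStructure_nabla₄,
    isAffineStructure_nabla₄' a b c, isCompatibleWith_nabla₄, isCompatibleWith_nabla₄' a b c,
    areCompatible_nabla₄ a b c⟩, inferInstance, fun p q => ?_, maurerCartan_pair₄ a b c,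
    (pair₄ a b c).bracket_apply, fun h => ?_, fun h => ?_, (hN a b c).isHypersymplectic,
    (pair₄ a b c).isInducedThrough_mul_left, (hN a b c).isNeutralKahler, (hN a b c).isRicciFlat,
    (hN a b c).isComplete, (hN a b c).isFlat_iff.trans (cubic_pair₄_eq_zero_iff a b c),
    exists_discrete_cocompact, fun Γ hΓ hΓc => ?_⟩, metric_pair₄, ?_⟩
  · rw [← alpha_pair₄, ← beta_pair₄]
    rfl
  · have h' := mt (cubic_pair₄_eq_zero_iff a b c).1 h
    push Not at h'
    obtain ⟨x, y, z, hxyz⟩ := h'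
    exact ⟨(pair₄ a b c).nilpotencyClass_eq_three hxyz,
      AffineSymplecticPair.nilpotencyLength_eq_three hxyz⟩
  · have h' := (cubic_pair₄_eq_zero_iff a b c).2 h
    exact ⟨(pair₄ a b c).nilpotencyClass_eq_two h' nabla₄_ne_zero,
      AffineSymplecticPair.nilpotencyLength_eq_two h' nabla₄_ne_zero⟩
  · let := AffineSymplecticPair.quotientChartedSpace Γ
    have := AffineSymplecticPair.isManifold_quotient (Γ := Γ)
    have hπ := AffineSymplecticPair.isLocalModel_proj (Γ := Γ)
    exact ⟨AffineSymplecticPair.compactSpace_quotient, AffineSymplecticPair.t2Space_quotient,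
      inferInstance, _, _, _, this, hπ.isLocalDiffeomorph, hπ.isInducedThrough,
      hπ.isHypersymplectic, hπ.isNeutralKahler, hπ.isRicciFlat, hπ.isComplete,
      hπ.isFlat_iff.trans (cubic_pair₄_eq_zero_iff a b c)⟩
  · rw [explicitMetric_eq_metric]
    exact ⟨⟨(pair₄ 0 1 0).J, (hN 0 1 0).isNeutralKahler⟩, (hN 0 1 0).isRicciFlat,
      (hN 0 1 0).isComplete, fun h => one_ne_zero
        (((hN 0 1 0).isFlat_iff.trans (cubic_pair₄_eq_zero_iff 0 1 0)).1 h)⟩
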